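/- Let $k\ge 1$ be an integer, let $\boldsymbol\alpha=(\alpha_1,\dots,\alpha_k)\in(0,1]^k$ with $\sum_{i}\alpha_i=1$, and let $P=(p_{ij})_{1\le i,j\le k}$ be a symmetric matrix with all entries in $(0,1)$; write $p_i:=p_{ii}$. All of these are fixed. For $n\in\mathbb N$ let $n_i:=\lfloor\alpha_i n\rfloor$ for $i<k$ and $n_k:=n-\sum_{i<k}n_i$. Let $G(n,\boldsymbol\alpha,P)$ be the random graph on a vertex set of size $n$ that is the disjoint union of $V_1,\dots,V_k$ with $|V_i|=n_i$, in which any two distinct vertices $u\in V_i$ and $v\in V_j$ are adjacent with probability $p_{ij}$, independently for all pairs. Let $G(m,p)$ be the binomial random graph on $m$ vertices with edge probability $p$, and let $\chi$ denote the chromatic number. For each $n$ let $G_n\sim G(n,\boldsymbol\alpha,P)$ and $H_{n,i}\sim G(n_i,p_i)$, $1\le i\le k$, be defined on a common probability space, with an arbitrary joint distribution (for example $H_{n,i}=G_n[V_i]$, or all of them independent). Then, with high probability, $$\chi(G_n)=(1+o(1))\sum_{i=1}^k\chi(H_{n,i}),$$ that is, for every $\varepsilon>0$, $$\Pr\Big[\,\Big|\chi(G_n)-\sum_{i=1}^k\chi(H_{n,i})\Big|\le\varepsilon\sum_{i=1}^k\chi(H_{n,i})\Big]\longrightarrow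 1\qquad(n\to\infty),$$ if and only if $p_{ij}\ge 1-\sqrt{(1-p_i)(1-p_j)}$ for all $1\le i<j\le k$. -/

import Mathlib

open MeasureTheory ProbabilityTheory Filter
open scoped Topology unitInterval

noncomputable section

namespace RandomBlockGraph

/-- The size of the `i`-th part of the vertex set: `⌊α i * n⌋` for every part but the last one,
which takes all the remaining ones of the `n` vertices. -/
def blockSize {k : ℕ} (α : Fin k → ℝ) (n : ℕ) (i : Fin k) : ℕ :=
  if (i : ℕ) + 1 = k then n - ∑ j ∈ Finset.univ.filter (fun j : Fin k => (j : ℕ) + 1 < k), ⌊α j * n⌋₊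
  else ⌊α i * n⌋₊

/-- The vertex set `V = V₁ ⊔ ⋯ ⊔ V_k`; a vertex is a pair of the index of its part and its
position in that part. -/
abbrev BlockVertex {k : ℕ} (α : Fin k → ℝ) (n : ℕ) : Type :=
  Σ i : Fin k, Fin (blockSize α n i)

/-- The law of the random graph on the finite vertex set `V` in which every unordered pair `e` of
distinct vertices is an edge with probability `p e`, independently of all other pairs. (One coin is
tossed for every `e : Sym2 V`; `SimpleGraph.fromEdgeSet` ignores the coins on the diagonal.) -/
def independentEdges (V : Type*) [Fintype V] [DecidableEq V] (p : Sym2 V → I) :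
    Measure (SimpleGraph V) :=
  (Measure.pi fun e : Sym2 V => bernoulliMeasure True False (p e)).map
    fun coin => SimpleGraph.fromEdgeSet {e | coin e}

/-- The law of the random block graph `G(n, α, P)`: distinct vertices `u ∈ V_i`, `v ∈ V_j` are
adjacent with probability `P i j`, independently for all pairs. -/
def blockRandom {k : ℕ} (n : ℕ) (α : Fin k → ℝ) (P : Matrix (Fin k) (Fin k) I) (hP : P.IsSymm) :
    Measure (SimpleGraph (BlockVertex α n)) :=
  independentEdges (BlockVertex α n)
    (Sym2.lift ⟨fun u v => P u.1 v.1, fun u v => hP.apply v.1 u.1⟩)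

/-- The chromatic number of a graph on a finite vertex set, as a real number. -/
def chi {V : Type*} [Finite V] (G : SimpleGraph V) : ℝ := (G.chromaticNumber.toNat : ℝ)

/-- With high probability `X n = (1 + o(1)) Y n`: for every `ε > 0`, the probability that
`|X n - Y n| ≤ ε * Y n` tends to one. -/
def WhpAsymptoticallyEq {Ω : ℕ → Type*} [∀ n, MeasurableSpace (Ω n)] (μ : ∀ n, Measure (Ω n))
    (X Y : ∀ n, Ω n → ℝ) : Prop :=
  ∀ ε : ℝ, 0 < ε →
    Tendsto (fun n => μ n {ω | |X n ω - Y n ω| ≤ ε * Y n ω}) atTop (𝓝 1)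

end RandomBlockGraph

end

/-! Write c_i = -log(1 - p_i), c_ij = -log(1 - p_ij) and C = Σ α_i c_i. After taking logarithms
(`one_sub_sqrt_le_iff`) the condition reads c_ij ≥ (c_i + c_j)/2. Each χ(H_{n,i}) is (α_i c_i/2 +
o(1)) n/log n, so the sum is asymptotically (C/2) n/log n, and the question is whether χ(G_n) has
the same order constant. Colouring the parts with disjoint palettes shows that it is never larger
(`tendsto_lt_chi`).

Lower bound under the condition: give every vertex of V_i the weight c_i. A set S of weight w is
independent with probability at most exp(-(|S| - 1)w/2) (`le_sum_pairs`), so by the first moment no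
independent set has weight (2 + ε) log n (`exists_heavy_isIndepSet_le`). The total weight is about
Cn, which forces χ(G_n) ≥ (C/2 - o(1)) n/log n (`tendsto_chi_lt`).

If the condition fails for i, j, the cheap cross pairs allow independent sets with about log n/c_i
vertices in V_i and (1 + η) log n/c_j in V_j, of weight about (2 + η) log n. Using such sets as
colour classes on a positive fraction of both parts saves a constant factor
(`exists_tendsto_lt_chi`).

Existence of the classes, mixed or inside one part, comes from Janson's inequality
(`subsetExp_meets_all_le`, `no_profile_isIndepSet_le`): if no sub-profile is too costly, failure has
probability exp(-n^{3/2}/6), which beats a union bound over 4^n pairs of vertex sets. So all sets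
with at least n/log² n vertices contain such classes, they can be removed greedily, and giving the
leftover vertices private colours costs only o(n/log n). -/

noncomputable section

namespace RandomBlockGraph

/-! ### Harris and Janson inequalities for a random subset -/

section Janson

variable {E : Type*} [DecidableEq E]

/-- The indicator of the event that a random set avoids `Q`. -/
def avoids (Q A : Finset E) : ℝ := if Disjoint Q A then 1 else 0

lemma avoids_nonneg (Q A : Finset E) : 0 ≤ avoids Q A := by
  unfold avoids; split_ifs <;> simp

lemma avoids_antitone (Q : Finset E) : Antitone (avoids Q) := by
  intro A B h
  by_cases hB : Disjoint Q B
  · simp [avoids, hB, hB.mono_right h]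
  · simpa [avoids, hB] using avoids_nonneg Q A

lemma avoids_mul (Q R A : Finset E) : avoids Q A * avoids R A = avoids (Q ∪ R) A := by
  unfold avoids
  by_cases h1 : Disjoint Q A <;> by_cases h2 : Disjoint R A <;>
    simp [h1, h2, Finset.disjoint_union_left]

variable [Fintype E]

/-- The probability that a random subset of `E`, containing every `e` independently with
probability `p e`, equals `A`. -/
def subsetWeight (p : E → ℝ) (A : Finset E) : ℝ := ∏ e, if e ∈ A then p e else 1 - p e

/-- The expectation of `f` at a random subset of `E`, which contains every `e` independently with
probability `p e`. -/
def subsetExp (p : E → ℝ) (f : Finset E → ℝ) : ℝ := ∑ A, subsetWeight p A * f A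

variable {p : E → ℝ}

lemma subsetWeight_nonneg (h0 : ∀ e, 0 ≤ p e) (h1 : ∀ e, p e < 1) (A : Finset E) :
    0 ≤ subsetWeight p A := by
  refine Finset.prod_nonneg fun e _ => ?_
  split_ifs
  · exact h0 e
  · linarith [h1 e]

lemma subsetExp_mono (h0 : ∀ e, 0 ≤ p e) (h1 : ∀ e, p e < 1) {f g : Finset E → ℝ}
    (h : ∀ A, f A ≤ g A) : subsetExp p f ≤ subsetExp p g :=
  Finset.sum_le_sum fun A _ => mul_le_mul_of_nonneg_left (h A) (subsetWeight_nonneg h0 h1 A)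

lemma subsetExp_sum {ι : Type*} (s : Finset ι) (f : ι → Finset E → ℝ) :
    subsetExp p (fun A => ∑ i ∈ s, f i A) = ∑ i ∈ s, subsetExp p (f i) := by
  simp only [subsetExp, Finset.mul_sum]
  exact Finset.sum_comm

lemma subsetExp_one : subsetExp p (fun _ => 1) = 1 := by
  have h := Finset.prod_add p (fun e => 1 - p e) Finset.univ
  simp only [add_sub_cancel, Finset.prod_const_one, Finset.powerset_univ] at h
  refine Eq.trans (Finset.sum_congr rfl fun A _ => ?_) h.symm
  rw [mul_one, subsetWeight, Finset.prod_ite]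
  congr 2 <;> ext <;> simp

/-- A product weight is log-modular, since each coordinate contributes the same two factors on both
sides; this feeds the lattice condition of `fkg`. -/
lemma subsetWeight_mul (A B : Finset E) :
    subsetWeight p A * subsetWeight p B = subsetWeight p (A ⊓ B) * subsetWeight p (A ⊔ B) := by
  simp only [subsetWeight, ← Finset.prod_mul_distrib]
  refine Finset.prod_congr rfl fun e _ => ?_
  by_cases h1 : e ∈ A <;> by_cases h2 : e ∈ B <;> simp [h1, h2, mul_comm]

/-- Grouping each `A` without `e` with `insert e A` isolates the coin of `e`, on which `g` does not
depend. -/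
lemma subsetExp_notMem_mul (e : E) {g : Finset E → ℝ} (hg : ∀ A, g (insert e A) = g A) :
    subsetExp p (fun A => if e ∈ A then 0 else g A) = (1 - p e) * subsetExp p g := by
  have key (f : Finset E → ℝ) : subsetExp p f =
      ∑ A ∈ (Finset.univ.erase e).powerset, (subsetWeight p A * f A +
        subsetWeight p (insert e A) * f (insert e A)) := by
    rw [Finset.sum_add_distrib, ← Finset.sum_powerset_insert (Finset.notMem_erase e Finset.univ)
      (fun A => subsetWeight p A * f A), Finset.insert_erase (Finset.mem_univ e)]
    simp [subsetExp]
  rw [key, key, Finset.mul_sum]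
  refine Finset.sum_congr rfl fun A hA => ?_
  have heA : e ∉ A := fun h => by simpa using Finset.mem_powerset.1 hA h
  have hw1 : subsetWeight p A = (1 - p e) * ∏ x ∈ Finset.univ.erase e,
      if x ∈ A then p x else 1 - p x := by
    rw [subsetWeight, ← Finset.mul_prod_erase _ _ (Finset.mem_univ e), if_neg heA]
  have hw2 : subsetWeight p (insert e A) = p e * ∏ x ∈ Finset.univ.erase e,
      if x ∈ A then p x else 1 - p x := by
    rw [subsetWeight, ← Finset.mul_prod_erase _ _ (Finset.mem_univ e),
      if_pos (Finset.mem_insert_self e A)]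
    congr 1
    refine Finset.prod_congr rfl fun x hx => ?_
    simp [Finset.ne_of_mem_erase hx]
  simp only [heA, if_false, Finset.mem_insert_self, if_true, hg, hw1, hw2]
  ring

lemma subsetExp_avoids_mul (Q : Finset E) {g : Finset E → ℝ}
    (hg : ∀ e ∈ Q, ∀ A, g (insert e A) = g A) :
    subsetExp p (fun A => avoids Q A * g A) = (∏ e ∈ Q, (1 - p e)) * subsetExp p g := by
  induction Q using Finset.induction_on with
  | empty => simp [avoids]
  | insert e Q he ih =>
    rw [Finset.prod_insert he, mul_assoc, ← ih fun x hx => hg x (Finset.mem_insert_of_mem hx),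
      ← subsetExp_notMem_mul]
    · congr 1
      ext A
      by_cases h : e ∈ A <;> simp [avoids, h]
    · intro A
      rw [hg e (Finset.mem_insert_self e Q)]
      simp [avoids, he]

lemma subsetExp_avoids (Q : Finset E) : subsetExp p (avoids Q) = ∏ e ∈ Q, (1 - p e) := by
  simpa [subsetExp_one] using subsetExp_avoids_mul (p := p) Q (g := fun _ => 1) (by simp)

/-- The Harris inequality, conditionally on avoiding `Q`. -/
lemma subsetExp_avoids_mul_le (h0 : ∀ e, 0 ≤ p e) (h1 : ∀ e, p e < 1) (Q : Finset E)
    {f g : Finset E → ℝ} (hf0 : 0 ≤ f) (hg0 : 0 ≤ g) (hf : Monotone f) (hg : Monotone g)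
    (hgQ : ∀ e ∈ Q, ∀ A, g (insert e A) = g A) :
    subsetExp p (fun A => avoids Q A * f A) * subsetExp p g ≤
      subsetExp p (fun A => avoids Q A * (f A * g A)) := by
  have hpos : 0 < ∏ e ∈ Q, (1 - p e) := Finset.prod_pos fun e _ => by linarith [h1 e]
  -- The sets avoiding `Q` form a sublattice, so the restricted weight is still log-supermodular.
  -- Since `g` ignores `Q`, its restricted sum is a multiple of its expectation, and the probability
  -- of avoiding `Q` cancels.
  have h := fkg (μ := fun A => subsetWeight p A * avoids Q A) (f := f) (g := g)
    (fun A => mul_nonneg (subsetWeight_nonneg h0 h1 A) (avoids_nonneg Q A)) hf0 hg0 hf hg ?_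
  · have e1 := subsetExp_avoids_mul (p := p) Q hgQ
    have e2 := subsetExp_avoids (p := p) Q
    simp only [subsetExp, ← mul_assoc] at e1 e2 h ⊢
    rw [e1, e2] at h
    refine le_of_mul_le_mul_left (le_trans (le_of_eq ?_) h) hpos
    ring
  · intro A B
    have hA : avoids Q A * avoids Q B ≤ avoids Q (A ⊓ B) * avoids Q (A ⊔ B) := by
      by_cases hA : Disjoint Q A <;> by_cases hB : Disjoint Q B <;>
        simp [avoids, hA, hB, Finset.disjoint_union_right]
      simp [hA.mono_right (Finset.inter_subset_left (s₂ := B))]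
    calc _ = (subsetWeight p A * subsetWeight p B) * (avoids Q A * avoids Q B) := by ring
      _ ≤ (subsetWeight p A * subsetWeight p B) * (avoids Q (A ⊓ B) * avoids Q (A ⊔ B)) :=
        mul_le_mul_of_nonneg_left hA
          (mul_nonneg (subsetWeight_nonneg h0 h1 A) (subsetWeight_nonneg h0 h1 B))
      _ = _ := by rw [subsetWeight_mul]; ring

/-- The expected number of sets `Q i` that the random set avoids. -/
def avoidMean (p : E → ℝ) {ι : Type*} (s : Finset ι) (Q : ι → Finset E) : ℝ :=
  ∑ i ∈ s, ∏ e ∈ Q i, (1 - p e)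

/-- The expected number of ordered pairs of intersecting sets `Q i`, `Q j` that the random set
avoids. -/
def avoidCorr (p : E → ℝ) {ι : Type*} (s : Finset ι) (Q : ι → Finset E) : ℝ :=
  ∑ i ∈ s, ∑ j ∈ s with ¬ Disjoint (Q i) (Q j), ∏ e ∈ Q i ∪ Q j, (1 - p e)

/-- Split the exponential into the factor `f` from the sets meeting `Q i` and the factor `g` from
those disjoint from it. Harris detaches `g`, and `1 + x ≤ exp x` bounds `f` below. This is the
differential inequality behind Janson, one term at a time. -/
lemma subsetExp_avoids_mul_exp_ge (h0 : ∀ e, 0 ≤ p e) (h1 : ∀ e, p e < 1) {ι : Type*}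
    (s : Finset ι) (Q : ι → Finset E) (i : ι) {t : ℝ} (ht : 0 ≤ t) :
    (∏ e ∈ Q i, (1 - p e) - t * ∑ j ∈ s with ¬ Disjoint (Q i) (Q j),
        ∏ e ∈ Q i ∪ Q j, (1 - p e)) *
      subsetExp p (fun A => Real.exp (-t * ∑ j ∈ s, avoids (Q j) A)) ≤
      subsetExp p (fun A => avoids (Q i) A * Real.exp (-t * ∑ j ∈ s, avoids (Q j) A)) := by
  set f : Finset E → ℝ := fun A =>
    Real.exp (-t * ∑ j ∈ s with ¬ Disjoint (Q i) (Q j), avoids (Q j) A) with hf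
  set g : Finset E → ℝ := fun A =>
    Real.exp (-t * ∑ j ∈ s with Disjoint (Q i) (Q j), avoids (Q j) A) with hg
  have hmono (u : Finset ι) : Monotone fun A => Real.exp (-t * ∑ j ∈ u, avoids (Q j) A) := by
    intro A B h
    refine Real.exp_le_exp.2 (mul_le_mul_of_nonpos_left ?_ (by linarith))
    exact Finset.sum_le_sum fun j _ => avoids_antitone (Q j) h
  have hfg (A : Finset E) : Real.exp (-t * ∑ j ∈ s, avoids (Q j) A) = f A * g A := by
    rw [hf, hg, ← Real.exp_add, ← mul_add, add_comm, Finset.sum_filter_add_sum_filter_not]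
  have hle := subsetExp_avoids_mul_le h0 h1 (Q i) (f := f) (g := g)
    (fun A => (Real.exp_pos _).le) (fun A => (Real.exp_pos _).le) (hmono _) (hmono _) (by
      intro e he A
      refine congrArg (fun x : ℝ => Real.exp (-t * x)) (Finset.sum_congr rfl fun j hj => ?_)
      have : e ∉ Q j := Finset.disjoint_left.1 (Finset.mem_filter.1 hj).2 he
      simp [avoids, this])
  simp only [hfg]
  refine le_trans ?_ hle
  have hg0 : 0 ≤ subsetExp p (fun A => f A * g A) :=
    Finset.sum_nonneg fun A _ => mul_nonneg (subsetWeight_nonneg h0 h1 A)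
      (mul_nonneg (Real.exp_pos _).le (Real.exp_pos _).le)
  have hfgg : subsetExp p (fun A => f A * g A) ≤ subsetExp p g := by
    refine subsetExp_mono h0 h1 fun A => mul_le_of_le_one_left (Real.exp_pos _).le ?_
    refine Real.exp_le_one_iff.2 (mul_nonpos_of_nonpos_of_nonneg (by linarith) ?_)
    exact Finset.sum_nonneg fun j _ => avoids_nonneg _ _
  have hIf0 : 0 ≤ subsetExp p (fun A => avoids (Q i) A * f A) :=
    Finset.sum_nonneg fun A _ => mul_nonneg (subsetWeight_nonneg h0 h1 A)
      (mul_nonneg (avoids_nonneg _ _) (Real.exp_pos _).le)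
  -- The left factor may be negative, so it is first replaced by the nonnegative expectation
  -- involving `f`; only then is `f * g` enlarged to `g`.
  refine le_trans (mul_le_mul_of_nonneg_right ?_ hg0) (mul_le_mul_of_nonneg_left hfgg hIf0)
  simp only [← subsetExp_avoids]
  rw [← subsetExp_sum]
  simp only [subsetExp, Finset.mul_sum, ← Finset.sum_sub_distrib]
  refine Finset.sum_le_sum fun A _ => ?_
  have hexp := Real.add_one_le_exp
    (-t * ∑ j ∈ s with ¬ Disjoint (Q i) (Q j), avoids (Q j) A)
  have hw := subsetWeight_nonneg h0 h1 A
  have ha := avoids_nonneg (Q i) A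
  have hsum : ∑ j ∈ s with ¬ Disjoint (Q i) (Q j), avoids (Q i ∪ Q j) A =
      avoids (Q i) A * ∑ j ∈ s with ¬ Disjoint (Q i) (Q j), avoids (Q j) A := by
    simp only [Finset.mul_sum, avoids_mul]
  have := mul_le_mul_of_nonneg_left hexp (mul_nonneg hw ha)
  rw [← Finset.mul_sum, ← Finset.mul_sum, hsum]
  rw [hf]
  linarith

/-- **Janson's inequality**: the random set meets every `Q i` with probability at most
`exp (-μ² / 2Δ)`. -/
theorem subsetExp_meets_all_le (h0 : ∀ e, 0 ≤ p e) (h1 : ∀ e, p e < 1) {ι : Type*}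
    (s : Finset ι) (Q : ι → Finset E) (hΔ : 0 < avoidCorr p s Q) :
    subsetExp p (fun A => if ∀ i ∈ s, ¬ Disjoint (Q i) A then 1 else 0) ≤
      Real.exp (-(avoidMean p s Q ^ 2 / (2 * avoidCorr p s Q))) := by
  set m := avoidMean p s Q with hm
  set Δ := avoidCorr p s Q with hD
  set X : Finset E → ℝ := fun A => ∑ i ∈ s, avoids (Q i) A with hX
  set Ψ : ℝ → ℝ := fun t => subsetExp p (fun A => Real.exp (-t * X A)) with hΨ
  have hder (t : ℝ) : HasDerivAt Ψ (-subsetExp p (fun A => X A * Real.exp (-t * X A))) t := by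
    have : HasDerivAt Ψ (∑ A, subsetWeight p A * (Real.exp (-t * X A) * (-1 * X A))) t := by
      refine HasDerivAt.fun_sum fun A _ => HasDerivAt.const_mul _ (HasDerivAt.exp ?_)
      exact (hasDerivAt_neg t).mul_const (X A)
    convert this using 1
    simp only [subsetExp, ← Finset.sum_neg_distrib]
    exact Finset.sum_congr rfl fun A _ => by ring
  have hlow (t : ℝ) (ht : 0 ≤ t) :
      (m - t * Δ) * Ψ t ≤ subsetExp p (fun A => X A * Real.exp (-t * X A)) := by
    have hsum := Finset.sum_le_sum (s := s) fun i _ => subsetExp_avoids_mul_exp_ge h0 h1 s Q i ht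
    rw [← Finset.sum_mul, Finset.sum_sub_distrib, ← Finset.mul_sum, ← subsetExp_sum] at hsum
    simpa only [hm, hD, hX, hΨ, avoidMean, avoidCorr, Finset.sum_mul] using hsum
  -- Integrating factor for `Ψ' ≤ -(m - t * Δ) * Ψ`. As `Φ 0 = 1`, it yields a Gaussian bound on the
  -- Laplace transform `Ψ`, which is optimal at `t = m / Δ`.
  set Φ : ℝ → ℝ := fun t => Ψ t * Real.exp (m * t - Δ * t ^ 2 / 2) with hΦ
  have hΦder (t : ℝ) : HasDerivAt Φ
      (-subsetExp p (fun A => X A * Real.exp (-t * X A)) * Real.exp (m * t - Δ * t ^ 2 / 2) +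
        Ψ t * (Real.exp (m * t - Δ * t ^ 2 / 2) * (m - Δ * t))) t := by
    refine (hder t).mul (HasDerivAt.exp ?_)
    have h := ((hasDerivAt_id t).const_mul m).sub
      ((((hasDerivAt_id t).pow 2).const_mul Δ).div_const 2)
    exact h.congr_deriv (by simp; ring)
  have hanti : AntitoneOn Φ (Set.Ici 0) := by
    refine antitoneOn_of_deriv_nonpos (convex_Ici 0)
      (fun t _ => (hΦder t).continuousAt.continuousWithinAt)
      (fun t _ => (hΦder t).differentiableAt.differentiableWithinAt) fun t ht => ?_
    rw [interior_Ici, Set.mem_Ioi] at ht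
    rw [(hΦder t).deriv]
    have := mul_le_mul_of_nonneg_right (hlow t ht.le) (Real.exp_pos (m * t - Δ * t ^ 2 / 2)).le
    linarith
  have hmnn : 0 ≤ m := Finset.sum_nonneg fun i _ =>
    Finset.prod_nonneg fun e _ => by linarith [h1 e]
  have ht0 : 0 ≤ m / Δ := div_nonneg hmnn hΔ.le
  have hfin := hanti (Set.mem_Ici.2 le_rfl) (Set.mem_Ici.2 ht0) ht0
  have hΦ0 : Φ 0 = 1 := by simp [hΦ, hΨ, subsetExp_one]
  rw [hΦ0] at hfin
  have hexp : m * (m / Δ) - Δ * (m / Δ) ^ 2 / 2 = m ^ 2 / (2 * Δ) := by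
    field_simp
    ring
  simp only [hΦ, hexp] at hfin
  rw [Real.exp_neg, ← one_div]
  refine le_trans ?_ ((le_div_iff₀ (Real.exp_pos _)).2 hfin)
  -- Markov's inequality: the exponential equals 1 on the event `X A = 0`.
  refine subsetExp_mono h0 h1 fun A => ?_
  split_ifs with h
  · rw [hX]
    have : ∑ i ∈ s, avoids (Q i) A = 0 := Finset.sum_eq_zero fun i hi => by simp [avoids, h i hi]
    simp [this]
  · exact (Real.exp_pos _).le

end Janson

/-! ### Graph laws as finite expectations -/

section Law

lemma measurableSet_simpleGraph {V : Type*} [Finite V] (s : Set (SimpleGraph V)) :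
    MeasurableSet s := by
  have : Finite (SimpleGraph V) := Finite.of_injective _ SimpleGraph.edgeSet_injective
  have h1 (G : SimpleGraph V) : MeasurableSet {G} := by
    have := SimpleGraph.measurable_edgeSet (measurableSet_singleton (G.edgeSet))
    convert this using 1
    ext H
    simp
  have : MeasurableSingletonClass (SimpleGraph V) := ⟨h1⟩
  exact s.toFinite.measurableSet

lemma measurable_setOf_coin {E : Type*} : Measurable fun coin : E → Prop => {e | coin e} :=
  MeasurableEquiv.setOfPred.measurable

lemma measurable_fromEdgeSet_coin {V : Type*} :
    Measurable fun coin : Sym2 V → Prop => SimpleGraph.fromEdgeSet {e | coin e} :=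
  SimpleGraph.measurable_fromEdgeSet.comp measurable_setOf_coin

variable {V : Type*} [Fintype V] [DecidableEq V]

/-- The two constructions differ only in the coins on the diagonal, which `SimpleGraph.fromEdgeSet`
discards; masking those coins turns one product measure into the other. -/
lemma binomialRandom_eq_independentEdges (p : I) :
    SimpleGraph.binomialRandom V p = independentEdges V fun _ => p := by
  rw [SimpleGraph.binomialRandom_eq_map, setBernoulli_eq_map, Measure.infinitePi_eq_pi,
    Measure.map_map SimpleGraph.measurable_fromEdgeSet measurable_setOf_coin]
  have h : (fun i : Sym2 V => unitInterval.toNNReal p • Measure.dirac (i ∈ (Sym2.diagSetᶜ : Set (Sym2 V))) +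
      unitInterval.toNNReal (σ p) • Measure.dirac False) =
      fun i => (bernoulliMeasure True False p).map
        (fun c : Prop => c ∧ i ∈ (Sym2.diagSetᶜ : Set (Sym2 V))) := by
    ext1 i
    have hm : Measurable fun c : Prop => c ∧ i ∈ (Sym2.diagSetᶜ : Set (Sym2 V)) := by fun_prop
    rw [bernoulliMeasure_def, Measure.map_add _ _ hm, Measure.map_smul,
      Measure.map_smul, Measure.map_dirac' hm, Measure.map_dirac' hm]
    simp
  rw [h, ← Measure.pi_map_pi fun i => Measurable.aemeasurable (by fun_prop),
    Measure.map_map (SimpleGraph.measurable_fromEdgeSet.comp measurable_setOf_coin)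
      (by fun_prop), independentEdges]
  congr 1
  ext coin u v
  simp +contextual

lemma independentEdges_apply (p : Sym2 V → I) (Φ : SimpleGraph V → Prop) [DecidablePred Φ] :
    independentEdges V p {G | Φ G} = ENNReal.ofReal (subsetExp (fun e => (p e : ℝ))
      fun A => if Φ (SimpleGraph.fromEdgeSet (A : Set (Sym2 V))) then 1 else 0) := by
  classical
  rw [independentEdges, Measure.map_apply measurable_fromEdgeSet_coin (measurableSet_simpleGraph _)]
  set T : Finset (Finset (Sym2 V)) := Finset.univ.filter
    fun A => Φ (SimpleGraph.fromEdgeSet (A : Set (Sym2 V))) with hT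
  have hset : ((fun coin : Sym2 V → Prop => SimpleGraph.fromEdgeSet {e | coin e}) ⁻¹' {G | Φ G}) =
      ⋃ A ∈ T, {fun e => e ∈ A} := by
    ext coin
    simp only [Set.mem_preimage, Set.mem_ofPred_eq, hT, Finset.mem_filter, Finset.mem_univ,
      true_and, Set.mem_iUnion, Set.mem_singleton_iff, exists_prop]
    constructor
    · intro h
      refine ⟨Finset.univ.filter coin, ?_, by simp⟩
      simpa using h
    · rintro ⟨A, hA, rfl⟩
      exact hA
  rw [hset, measure_biUnion_finset]
  · have hw (A : Finset (Sym2 V)) :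
        (Measure.pi fun e : Sym2 V => bernoulliMeasure True False (p e)) {fun e => e ∈ A} =
          ENNReal.ofReal (subsetWeight (fun e => (p e : ℝ)) A) := by
      rw [Measure.pi_singleton, subsetWeight, ENNReal.ofReal_prod_of_nonneg]
      · refine Finset.prod_congr rfl fun e _ => ?_
        by_cases h : e ∈ A
        · simp [h, bernoulliMeasure_def]
          exact (ENNReal.ofReal_eq_coe_nnreal (p e).2.1).symm
        · simp [h, bernoulliMeasure_def]
          exact (ENNReal.ofReal_eq_coe_nnreal (σ (p e)).2.1).symm
      · intro e _
        split_ifs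
        exacts [(p e).2.1, sub_nonneg.2 (p e).2.2]
    simp only [hw]
    rw [← ENNReal.ofReal_sum_of_nonneg]
    · simp [subsetExp, hT, Finset.sum_filter]
    · intro A _
      refine Finset.prod_nonneg fun e _ => ?_
      split_ifs
      exacts [(p e).2.1, sub_nonneg.2 (p e).2.2]
  · intro A _ B _ hAB
    simp only [Function.onFun, Set.disjoint_singleton, ne_eq]
    intro h
    exact hAB (Finset.ext fun e => iff_of_eq (congrFun h e))
  · exact fun A _ => measurableSet_singleton _

end Law

/-! ### Counting sets that contain a given set -/

/-- The ratio of the two binomials is the product of (a - i)/(M - i) over i < u, and each factor is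
at most a/M. -/
lemma choose_sub_mul_pow_le {M a u : ℕ} (hu : u ≤ a) (ha : a ≤ M) :
    (M - u).choose (a - u) * M ^ u ≤ M.choose a * a ^ u := by
  induction u with
  | zero => simp
  | succ u ih =>
    have ih := ih (by omega)
    obtain ⟨c, rfl⟩ : ∃ c, a = u + 1 + c := ⟨a - (u + 1), by omega⟩
    obtain ⟨d, rfl⟩ : ∃ d, M = u + 1 + c + d := ⟨M - (u + 1 + c), by omega⟩
    have e1 : u + 1 + c + d - (u + 1) = c + d := by omega
    have e2 : u + 1 + c - (u + 1) = c := by omega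
    have e3 : u + 1 + c + d - u = c + d + 1 := by omega
    have e4 : u + 1 + c - u = c + 1 := by omega
    rw [e1, e2]
    rw [e3, e4] at ih
    have h := Nat.add_one_mul_choose_eq (c + d) c
    refine Nat.le_of_mul_le_mul_left (c := c + d + 1) ?_ (by omega)
    calc (c + d + 1) * ((c + d).choose c * (u + 1 + c + d) ^ (u + 1))
        = ((c + d + 1) * (c + d).choose c) * (u + 1 + c + d) ^ u * (u + 1 + c + d) := by ring
      _ = ((c + d + 1).choose (c + 1) * (u + 1 + c + d) ^ u) * ((c + 1) * (u + 1 + c + d)) := by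
        rw [h]; ring
      _ ≤ ((u + 1 + c + d).choose (u + 1 + c) * (u + 1 + c) ^ u) *
          ((u + 1 + c) * (c + d + 1)) := by
        refine Nat.mul_le_mul ih ?_
        nlinarith [Nat.zero_le (u * d)]
      _ = _ := by ring

lemma choose_sub_le_mul_pow {M a u : ℕ} (hu : u ≤ a) (ha : a ≤ M) {r m : ℝ}
    (hm : 0 < m) (h : a * m ≤ r * M) :
    ((M - u).choose (a - u) : ℝ) ≤ M.choose a * (r / m) ^ u := by
  have h1 : ((M - u).choose (a - u) : ℝ) * M ^ u ≤ M.choose a * a ^ u := by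
    exact_mod_cast choose_sub_mul_pow_le hu ha
  rcases Nat.eq_zero_or_pos M with rfl | hM
  · obtain rfl : a = 0 := by omega
    obtain rfl : u = 0 := by omega
    simp
  have hM' : (0 : ℝ) < M := by exact_mod_cast hM
  have h2 : (a : ℝ) ^ u ≤ (r / m) ^ u * M ^ u := by
    rw [← mul_pow]
    refine pow_le_pow_left₀ (by positivity) ?_ u
    rw [div_mul_eq_mul_div, le_div_iff₀ hm]
    exact h
  refine le_of_mul_le_mul_right ?_ (pow_pos hM' u)
  calc _ ≤ (M.choose a : ℝ) * a ^ u := h1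
    _ ≤ M.choose a * ((r / m) ^ u * M ^ u) := by gcongr
    _ = _ := by ring

lemma card_powersetCard_filter_superset_le {V : Type*} [DecidableEq V] (A R : Finset V) (a : ℕ)
    (hR : R ⊆ A) :
    ((A.powersetCard a).filter (R ⊆ ·)).card ≤ (A.card - R.card).choose (a - R.card) := by
  rw [← Finset.card_sdiff_of_subset hR, ← Finset.card_powersetCard]
  refine Finset.card_le_card_of_injOn (fun T => T \ R) ?_ ?_
  · intro T hT
    simp only [Finset.coe_filter, Finset.mem_powersetCard, Set.mem_ofPred_eq] at hT
    refine Finset.mem_coe.2 (Finset.mem_powersetCard.2 ⟨Finset.sdiff_subset_sdiff hT.1.1 le_rfl, ?_⟩)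
    rw [Finset.card_sdiff_of_subset hT.2, hT.1.2]
  · intro T hT T' hT' h
    simp only [Finset.coe_filter, Set.mem_ofPred_eq] at hT hT' h
    rw [← Finset.sdiff_union_of_subset hT.2, h, Finset.sdiff_union_of_subset hT'.2]

/-! ### Vertex pairs and their costs -/

section Pairs

variable {V : Type*} [DecidableEq V]

/-- The unordered pairs of distinct elements of `S`. -/
def pairs (S : Finset V) : Finset (Sym2 V) := S.sym2.filter fun e => ¬ e.IsDiag

lemma mk_mem_pairs {S : Finset V} {x y : V} : s(x, y) ∈ pairs S ↔ x ∈ S ∧ y ∈ S ∧ x ≠ y := by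
  simp [pairs, and_assoc]

lemma pairs_inter (S T : Finset V) : pairs S ∩ pairs T = pairs (S ∩ T) := by
  ext e
  induction e with
  | _ x y => simp only [Finset.mem_inter, mk_mem_pairs]; tauto

lemma pairs_nonempty {S : Finset V} : (pairs S).Nonempty ↔ 2 ≤ S.card := by
  rw [← Nat.lt_iff_add_one_le, Finset.one_lt_card]
  constructor
  · rintro ⟨e, he⟩
    induction e with
    | _ x y => obtain ⟨hx, hy, h⟩ := mk_mem_pairs.1 he; exact ⟨x, hx, y, hy, h⟩
  · rintro ⟨x, hx, y, hy, h⟩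
    exact ⟨s(x, y), mk_mem_pairs.2 ⟨hx, hy, h⟩⟩

lemma sum_pairs_insert {S : Finset V} {v : V} (hv : v ∉ S) (f : Sym2 V → ℝ) :
    ∑ e ∈ pairs (insert v S), f e = ∑ e ∈ pairs S, f e + ∑ y ∈ S, f s(v, y) := by
  have h : pairs (insert v S) = pairs S ∪ S.image fun y => s(v, y) := by
    ext e
    induction e with
    | _ x y =>
      simp only [mk_mem_pairs, Finset.mem_insert, Finset.mem_union, Finset.mem_image,
        Sym2.eq_iff]
      constructor
      · rintro ⟨rfl | hx, rfl | hy, hne⟩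
        · exact absurd rfl hne
        · exact Or.inr ⟨y, hy, Or.inl ⟨rfl, rfl⟩⟩
        · exact Or.inr ⟨x, hx, Or.inr ⟨rfl, rfl⟩⟩
        · exact Or.inl ⟨hx, hy, hne⟩
      · rintro (⟨hx, hy, hne⟩ | ⟨z, hz, ⟨rfl, rfl⟩ | ⟨rfl, rfl⟩⟩)
        · exact ⟨Or.inr hx, Or.inr hy, hne⟩
        · exact ⟨Or.inl rfl, Or.inr hz, fun h => hv (h ▸ hz)⟩
        · exact ⟨Or.inr hz, Or.inl rfl, fun h => hv (h ▸ hz)⟩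
  rw [h, Finset.sum_union, Finset.sum_image]
  · intro x _ y _ hxy
    exact Sym2.congr_right.1 hxy
  · rw [Finset.disjoint_left]
    intro e he he'
    obtain ⟨y, hy, rfl⟩ := Finset.mem_image.1 he'
    exact hv (mk_mem_pairs.1 he).1

/-- If each pair costs at least the mean of the weights of its two elements, then the total cost of
the pairs in `S` is at least `(|S| - 1) / 2` times the weight of `S`. -/
lemma le_sum_pairs (S : Finset V) (κ : V → ℝ) (f : Sym2 V → ℝ)
    (h : ∀ x y, x ≠ y → (κ x + κ y) / 2 ≤ f s(x, y)) :
    ((S.card : ℝ) - 1) / 2 * ∑ x ∈ S, κ x ≤ ∑ e ∈ pairs S, f e := by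
  induction S using Finset.induction_on with
  | empty => simp [pairs]
  | insert v S hv ih =>
    rw [sum_pairs_insert hv, Finset.card_insert_of_notMem hv, Finset.sum_insert hv]
    have h1 : ∑ y ∈ S, (κ v + κ y) / 2 ≤ ∑ y ∈ S, f s(v, y) :=
      Finset.sum_le_sum fun y hy => h v y fun hvy => hv (hvy ▸ hy)
    rw [← Finset.sum_div, Finset.sum_add_distrib, Finset.sum_const, nsmul_eq_mul] at h1
    push_cast
    linarith

/-- The cost of the pairs of a set with `u` vertices in one part and `v` in another one, if a pair
costs `c₁` or `c₂` inside the parts and `c₁₂` across. -/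
def profileCost (c₁ c₂ c₁₂ : ℝ) (u v : ℕ) : ℝ :=
  c₁ * (u * (u - 1) / 2) + c₂ * (v * (v - 1) / 2) + c₁₂ * (u * v)

lemma sum_pairs_eq_profileCost {A B : Finset V} (hAB : Disjoint A B) (f : Sym2 V → ℝ)
    {c₁ c₂ c₁₂ : ℝ} (h₁ : ∀ x ∈ A, ∀ y ∈ A, x ≠ y → f s(x, y) = c₁)
    (h₂ : ∀ x ∈ B, ∀ y ∈ B, x ≠ y → f s(x, y) = c₂)
    (h₁₂ : ∀ x ∈ A, ∀ y ∈ B, f s(x, y) = c₁₂) (R : Finset V) (hR : R ⊆ A ∪ B) :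
    ∑ e ∈ pairs R, f e = profileCost c₁ c₂ c₁₂ (R ∩ A).card (R ∩ B).card := by
  induction R using Finset.induction_on with
  | empty => simp [pairs, profileCost]
  | insert v R hv ih =>
    rw [Finset.insert_subset_iff] at hR
    have hsplit (g : V → ℝ) : ∑ y ∈ R, g y = ∑ y ∈ R ∩ A, g y + ∑ y ∈ R ∩ B, g y := by
      rw [← Finset.sum_union, ← Finset.inter_union_distrib_left, Finset.inter_eq_left.2 hR.2]
      exact (hAB.mono_left Finset.inter_subset_right).mono_right Finset.inter_subset_right
    rw [sum_pairs_insert hv, ih hR.2, hsplit]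
    rcases Finset.mem_union.1 hR.1 with hvA | hvB
    · have hvB : v ∉ B := Finset.disjoint_left.1 hAB hvA
      have hA (y) (hy : y ∈ R ∩ A) : f s(v, y) = c₁ := h₁ v hvA y (Finset.mem_inter.1 hy).2
        fun h => hv (h ▸ (Finset.mem_inter.1 hy).1)
      have hB (y) (hy : y ∈ R ∩ B) : f s(v, y) = c₁₂ := h₁₂ v hvA y (Finset.mem_inter.1 hy).2
      rw [Finset.insert_inter_of_mem hvA, Finset.insert_inter_of_notMem hvB,
        Finset.card_insert_of_notMem (fun h => hv (Finset.mem_inter.1 h).1),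
        Finset.sum_congr rfl hA, Finset.sum_congr rfl hB]
      simp only [Finset.sum_const, nsmul_eq_mul, profileCost]
      push_cast
      ring
    · have hvA : v ∉ A := Finset.disjoint_right.1 hAB hvB
      have hA (y) (hy : y ∈ R ∩ A) : f s(v, y) = c₁₂ := by
        rw [Sym2.eq_swap]
        exact h₁₂ y (Finset.mem_inter.1 hy).2 v hvB
      have hB (y) (hy : y ∈ R ∩ B) : f s(v, y) = c₂ := h₂ v hvB y (Finset.mem_inter.1 hy).2
        fun h => hv (h ▸ (Finset.mem_inter.1 hy).1)
      rw [Finset.insert_inter_of_mem hvB, Finset.insert_inter_of_notMem hvA,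
        Finset.card_insert_of_notMem (fun h => hv (Finset.mem_inter.1 h).1),
        Finset.sum_congr rfl hA, Finset.sum_congr rfl hB]
      simp only [Finset.sum_const, nsmul_eq_mul, profileCost]
      push_cast
      ring

lemma isIndepSet_fromEdgeSet_iff (S : Finset V) (A : Finset (Sym2 V)) :
    (SimpleGraph.fromEdgeSet (A : Set (Sym2 V))).IsIndepSet S ↔ Disjoint (pairs S) A := by
  rw [Finset.disjoint_left]
  constructor
  · intro h e he heA
    induction e with
    | _ x y =>
      obtain ⟨hx, hy, hne⟩ := mk_mem_pairs.1 he
      exact h hx hy hne (by simp [heA, hne])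
  · intro h x hx y hy hne hadj
    simp only [SimpleGraph.fromEdgeSet_adj, Finset.mem_coe] at hadj
    exact h (mk_mem_pairs.2 ⟨hx, hy, hne⟩) hadj.1

end Pairs

/-- By the binomial theorem the sum is (1 + 1/r)^|S| ≤ exp(|S|/r). -/
lemma sum_powerset_inv_pow_le {V : Type*} (S : Finset V) {r : ℝ} (hr : 0 < r)
    (hS : (S.card : ℝ) ≤ r) : ∑ R ∈ S.powerset, (1 / r) ^ R.card ≤ Real.exp 1 := by
  have h := Finset.sum_pow_mul_eq_add_pow (1 / r) (1 : ℝ) S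
  simp only [one_pow, mul_one] at h
  rw [h]
  calc (1 / r + 1) ^ S.card ≤ (Real.exp (1 / r)) ^ S.card :=
        pow_le_pow_left₀ (by positivity) (Real.add_one_le_exp _) _
    _ = Real.exp (S.card * (1 / r)) := by rw [Real.exp_nat_mul]
    _ ≤ Real.exp 1 := by
      refine Real.exp_le_exp.2 ?_
      rw [mul_one_div, div_le_one hr]
      exact hS

/-! ### First-moment and Janson bounds for independent sets -/

section Probability

variable {V : Type*} [DecidableEq V]

lemma prod_one_sub_eq_exp {E : Type*} (p : E → ℝ) (h1 : ∀ e, p e < 1) (Q : Finset E) :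
    ∏ e ∈ Q, (1 - p e) = Real.exp (-∑ e ∈ Q, -Real.log (1 - p e)) := by
  rw [Finset.sum_neg_distrib, neg_neg, Real.exp_sum]
  exact Finset.prod_congr rfl fun e _ => (Real.exp_log (by linarith [h1 e])).symm

/-- With high probability no independent set has weight `(2 + ε) log n` or more, if a pair of
distinct vertices is a non-edge with probability at most `exp (-(κ x + κ y) / 2)`. -/
theorem exists_heavy_isIndepSet_le [Fintype V] (p : Sym2 V → I) (h1 : ∀ e, (p e : ℝ) < 1) (κ : V → ℝ)
    {K ε : ℝ} (hK : 0 < K) (hκ : ∀ x, κ x ≤ K)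
    (hp : ∀ x y, x ≠ y → (κ x + κ y) / 2 ≤ -Real.log (1 - p s(x, y)))
    {n : ℕ} (hn : 0 < n) (hV : Fintype.card V ≤ n) (hε : 0 < ε)
    (hlarge : 2 ≤ ε / 2 * ((2 + ε) * Real.log n / K - 1)) :
    independentEdges V p {G | ∃ S : Finset V, G.IsIndepSet S ∧
      (2 + ε) * Real.log n ≤ ∑ x ∈ S, κ x} ≤ ENNReal.ofReal (Real.exp 1 / n) := by
  classical
  have hn' : (0 : ℝ) < n := by exact_mod_cast hn
  set θ := (2 + ε) * Real.log n with hθ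
  have h0 (e) : 0 ≤ (p e : ℝ) := (p e).2.1
  rw [independentEdges_apply]
  refine ENNReal.ofReal_le_ofReal ?_
  set s : Finset (Finset V) := Finset.univ.filter fun S => θ ≤ ∑ x ∈ S, κ x with hs
  calc _ ≤ subsetExp (fun e => (p e : ℝ)) (fun A => ∑ S ∈ s, avoids (pairs S) A) := by
        refine subsetExp_mono h0 h1 fun A => ?_
        split_ifs with h
        · obtain ⟨S, hS, hSκ⟩ := h
          rw [isIndepSet_fromEdgeSet_iff] at hS
          refine le_trans (le_of_eq ?_) (Finset.single_le_sum (f := fun S => avoids (pairs S) A)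
            (fun S _ => avoids_nonneg _ _) (Finset.mem_filter.2 ⟨Finset.mem_univ S, hSκ⟩))
          simp [avoids, hS]
        · exact Finset.sum_nonneg fun S _ => avoids_nonneg _ _
    _ = ∑ S ∈ s, ∏ e ∈ pairs S, (1 - (p e : ℝ)) := by
        rw [subsetExp_sum]
        exact Finset.sum_congr rfl fun S _ => subsetExp_avoids _
    _ ≤ ∑ S ∈ s, (1 / n) * (1 / (n : ℝ)) ^ S.card := by
        refine Finset.sum_le_sum fun S hS => ?_
        have hSκ : θ ≤ ∑ x ∈ S, κ x := (Finset.mem_filter.1 hS).2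
        rw [prod_one_sub_eq_exp _ h1]
        have hcost := le_sum_pairs S κ (fun e => -Real.log (1 - p e)) hp
        have hcard : θ / K ≤ S.card := by
          rw [div_le_iff₀ hK]
          refine hSκ.trans ((Finset.sum_le_card_nsmul S κ K fun x _ => hκ x).trans ?_)
          rw [nsmul_eq_mul]
        have hlog : 0 ≤ Real.log n := Real.log_natCast_nonneg n
        -- A heavy set has at least `θ / K` vertices, so the surplus ε/2 per vertex amounts to 2.
        -- This lifts the exponent from (|S| - 1) log n to (|S| + 1) log n, leaving a spare factor
        -- 1/n after the sum over all sets.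
        have h2 : 2 ≤ ε / 2 * ((S.card : ℝ) - 1) := by
          refine hlarge.trans ?_
          gcongr
        have h3 : 0 ≤ ((S.card : ℝ) - 1) / 2 := by
          by_contra h
          nlinarith
        have h4 := mul_le_mul_of_nonneg_left hSκ h3
        have h5 : ((S.card : ℝ) + 1) * Real.log n ≤ ((S.card : ℝ) - 1) / 2 * θ := by
          have := mul_le_mul_of_nonneg_right h2 hlog
          rw [hθ]
          linarith
        calc _ ≤ Real.exp (-(((S.card + 1 : ℕ) : ℝ) * Real.log n)) := by
              refine Real.exp_le_exp.2 (neg_le_neg ?_)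
              push_cast
              linarith
          _ = (1 / n) * (1 / (n : ℝ)) ^ S.card := by
              rw [Real.exp_neg, Real.exp_nat_mul, Real.exp_log hn', pow_succ, one_div,
                mul_inv, inv_pow, mul_comm]
    _ ≤ ∑ S ∈ (Finset.univ : Finset V).powerset, (1 / n) * (1 / (n : ℝ)) ^ S.card :=
        Finset.sum_le_sum_of_subset_of_nonneg (by simp) fun S _ _ => by positivity
    _ ≤ Real.exp 1 / n := by
        rw [← Finset.mul_sum, one_div_mul_eq_div]
        gcongr
        exact sum_powerset_inv_pow_le _ hn' (by exact_mod_cast hV)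

section Profile

variable {A B : Finset V} {a b : ℕ}

/-- The sets with `a` vertices in `A` and `b` vertices in `B`. -/
def profileSets (A B : Finset V) (a b : ℕ) : Finset (Finset V) :=
  (A.powersetCard a ×ˢ B.powersetCard b).image fun S => S.1 ∪ S.2

lemma mem_profileSets (hAB : Disjoint A B) {S : Finset V} :
    S ∈ profileSets A B a b ↔ S ⊆ A ∪ B ∧ (S ∩ A).card = a ∧ (S ∩ B).card = b := by
  simp only [profileSets, Finset.mem_image, Finset.mem_product, Finset.mem_powersetCard,
    Prod.exists]
  constructor
  · rintro ⟨S₁, S₂, ⟨⟨h1, h2⟩, h3, h4⟩, rfl⟩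
    have e1 : S₂ ∩ A = ∅ := Finset.disjoint_iff_inter_eq_empty.1 (hAB.symm.mono_left h3)
    have e2 : S₁ ∩ B = ∅ := Finset.disjoint_iff_inter_eq_empty.1 (hAB.mono_left h1)
    refine ⟨Finset.union_subset_union h1 h3, ?_, ?_⟩
    · rw [Finset.union_inter_distrib_right, e1, Finset.union_empty, Finset.inter_eq_left.2 h1, h2]
    · rw [Finset.union_inter_distrib_right, e2, Finset.empty_union, Finset.inter_eq_left.2 h3, h4]
  · rintro ⟨h, ha, hb⟩
    refine ⟨S ∩ A, S ∩ B, ⟨⟨Finset.inter_subset_right, ha⟩, Finset.inter_subset_right, hb⟩, ?_⟩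
    rw [← Finset.inter_union_distrib_left, Finset.inter_eq_left.2 h]

lemma card_eq_of_subset_union (hAB : Disjoint A B) {R : Finset V} (hR : R ⊆ A ∪ B) :
    R.card = (R ∩ A).card + (R ∩ B).card := by
  rw [← Finset.card_union_of_disjoint, ← Finset.inter_union_distrib_left,
    Finset.inter_eq_left.2 hR]
  exact (hAB.mono_left Finset.inter_subset_right).mono_right Finset.inter_subset_right

lemma card_profileSets (hAB : Disjoint A B) :
    (profileSets A B a b).card = A.card.choose a * B.card.choose b := by
  rw [profileSets, Finset.card_image_of_injOn, Finset.card_product, Finset.card_powersetCard,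
    Finset.card_powersetCard]
  rintro ⟨S₁, S₂⟩ hS ⟨T₁, T₂⟩ hT h
  simp only [Finset.coe_product, Set.mem_prod, Finset.mem_coe, Finset.mem_powersetCard] at hS hT
  have key {X Y : Finset V} (hX : X ⊆ A) (hY : Y ⊆ B) :
      (X ∪ Y) ∩ A = X ∧ (X ∪ Y) ∩ B = Y := by
    have e1 : Y ∩ A = ∅ := Finset.disjoint_iff_inter_eq_empty.1 (hAB.symm.mono_left hY)
    have e2 : X ∩ B = ∅ := Finset.disjoint_iff_inter_eq_empty.1 (hAB.mono_left hX)
    simp [Finset.union_inter_distrib_right, e1, e2, Finset.inter_eq_left.2 hX,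
      Finset.inter_eq_left.2 hY]
  have k1 := key hS.1.1 hS.2.1
  have k2 := key hT.1.1 hT.2.1
  simp only at h
  rw [h] at k1
  exact Prod.ext (k1.1.symm.trans k2.1) (k1.2.symm.trans k2.2)

/-- The count factors over the two sides, and every prescribed vertex costs a factor of at most `r /
m` on either side. -/
lemma card_profileSets_filter_superset_le (hAB : Disjoint A B) (ha : a ≤ A.card)
    (hb : b ≤ B.card) {r m : ℝ} (hr : 0 ≤ r) (hm : 0 < m) (hrA : a * m ≤ r * A.card)
    (hrB : b * m ≤ r * B.card) {R : Finset V} (hR : R ⊆ A ∪ B) (hRa : (R ∩ A).card ≤ a)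
    (hRb : (R ∩ B).card ≤ b) :
    (((profileSets A B a b).filter (R ⊆ ·)).card : ℝ) ≤
      (profileSets A B a b).card * (r / m) ^ R.card := by
  have h : ((profileSets A B a b).filter (R ⊆ ·)).card ≤
      ((A.powersetCard a).filter (R ∩ A ⊆ ·)).card *
        ((B.powersetCard b).filter (R ∩ B ⊆ ·)).card := by
    rw [← Finset.card_product]
    refine Finset.card_le_card_of_injOn (fun T => (T ∩ A, T ∩ B)) ?_ ?_
    · intro T hT
      simp only [Finset.coe_filter, Set.mem_ofPred_eq, mem_profileSets hAB] at hT
      simp only [Finset.coe_product, Set.mem_prod, Finset.coe_filter, Set.mem_ofPred_eq,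
        Finset.mem_powersetCard]
      exact ⟨⟨⟨Finset.inter_subset_right, hT.1.2.1⟩, Finset.inter_subset_inter_right hT.2⟩,
        ⟨Finset.inter_subset_right, hT.1.2.2⟩, Finset.inter_subset_inter_right hT.2⟩
    · intro T hT T' hT' h
      simp only [Finset.coe_filter, Set.mem_ofPred_eq, mem_profileSets hAB] at hT hT'
      simp only [Prod.mk.injEq] at h
      rw [← Finset.inter_eq_left.2 hT.1.1, ← Finset.inter_eq_left.2 hT'.1.1,
        Finset.inter_union_distrib_left, Finset.inter_union_distrib_left, h.1, h.2]
  calc (((profileSets A B a b).filter (R ⊆ ·)).card : ℝ)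
      ≤ (((A.powersetCard a).filter (R ∩ A ⊆ ·)).card : ℝ) *
        ((B.powersetCard b).filter (R ∩ B ⊆ ·)).card := by exact_mod_cast h
    _ ≤ ((A.card - (R ∩ A).card).choose (a - (R ∩ A).card) : ℝ) *
        ((B.card - (R ∩ B).card).choose (b - (R ∩ B).card) : ℝ) := by
      gcongr <;> exact card_powersetCard_filter_superset_le _ _ _ Finset.inter_subset_right
    _ ≤ (A.card.choose a * (r / m) ^ (R ∩ A).card) * (B.card.choose b * (r / m) ^ (R ∩ B).card) :=
      mul_le_mul (choose_sub_le_mul_pow hRa ha hm hrA) (choose_sub_le_mul_pow hRb hb hm hrB)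
        (by positivity) (by positivity)
    _ = _ := by
      rw [card_profileSets hAB, card_eq_of_subset_union hAB hR, pow_add]
      push_cast
      ring

/-- The probability that no set with `a` vertices in `A` and `b` in `B` is independent is at most
`exp (-1 / 6δ)`, if `δ` bounds the expected multiplicities of the sub-profiles. -/
theorem no_profile_isIndepSet_le [Fintype V] (p : Sym2 V → I) (h1 : ∀ e, (p e : ℝ) < 1)
    (hAB : Disjoint A B) {c₁ c₂ c₁₂ : ℝ}
    (h₁ : ∀ x ∈ A, ∀ y ∈ A, x ≠ y → -Real.log (1 - p s(x, y)) = c₁)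
    (h₂ : ∀ x ∈ B, ∀ y ∈ B, x ≠ y → -Real.log (1 - p s(x, y)) = c₂)
    (h₁₂ : ∀ x ∈ A, ∀ y ∈ B, -Real.log (1 - p s(x, y)) = c₁₂)
    (ha : a ≤ A.card) (hb : b ≤ B.card) (hab : 2 ≤ a + b) {r m δ : ℝ} (hm : 0 < m)
    (hrab : (a + b : ℝ) ≤ r) (hrA : a * m ≤ r * A.card) (hrB : b * m ≤ r * B.card)
    (hδ0 : 0 < δ) (hδ : ∀ u v : ℕ, u ≤ a → v ≤ b → 2 ≤ u + v →
      (r ^ 2 / m) ^ (u + v) * Real.exp (profileCost c₁ c₂ c₁₂ u v) ≤ δ) :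
    independentEdges V p {G | ∀ S : Finset V, S ⊆ A ∪ B → (S ∩ A).card = a → (S ∩ B).card = b →
      ¬ G.IsIndepSet S} ≤ ENNReal.ofReal (Real.exp (-(1 / (6 * δ)))) := by
  classical
  have h0 (e) : 0 ≤ (p e : ℝ) := (p e).2.1
  have hr : 0 < r := lt_of_lt_of_le (by exact_mod_cast (by omega : 0 < a + b)) hrab
  rw [independentEdges_apply]
  refine ENNReal.ofReal_le_ofReal ?_
  set s := profileSets A B a b with hs
  set q : Sym2 V → ℝ := fun e => (p e : ℝ) with hq
  set P₀ := Real.exp (-profileCost c₁ c₂ c₁₂ a b) with hP₀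
  have hprod (R : Finset V) (hR : R ⊆ A ∪ B) : ∏ e ∈ pairs R, (1 - q e) =
      Real.exp (-profileCost c₁ c₂ c₁₂ (R ∩ A).card (R ∩ B).card) := by
    rw [prod_one_sub_eq_exp q h1, sum_pairs_eq_profileCost hAB _ h₁ h₂ h₁₂ R hR]
  have hprodS (S) (hS : S ∈ s) : ∏ e ∈ pairs S, (1 - q e) = P₀ := by
    obtain ⟨hS, hSa, hSb⟩ := (mem_profileSets hAB).1 hS
    rw [hprod S hS, hSa, hSb]
  have hmean : avoidMean q s pairs = s.card * P₀ := by
    rw [avoidMean, Finset.sum_congr rfl hprodS, Finset.sum_const, nsmul_eq_mul]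
  have hsub (S) (hS : S ∈ s) (R) (hR : R ⊆ S) :
      R ⊆ A ∪ B ∧ (R ∩ A).card ≤ a ∧ (R ∩ B).card ≤ b := by
    obtain ⟨hS, hSa, hSb⟩ := (mem_profileSets hAB).1 hS
    exact ⟨hR.trans hS, hSa ▸ Finset.card_le_card (Finset.inter_subset_inter_right hR),
      hSb ▸ Finset.card_le_card (Finset.inter_subset_inter_right hR)⟩
  have hScard (S) (hS : S ∈ s) : S.card = a + b := by
    obtain ⟨hS, hSa, hSb⟩ := (mem_profileSets hAB).1 hS
    rw [card_eq_of_subset_union hAB hS, hSa, hSb]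
  set F : Finset V → ℝ := fun R =>
    Real.exp (profileCost c₁ c₂ c₁₂ (R ∩ A).card (R ∩ B).card) with hF
  -- The pairs inside `S ∩ T` are counted twice in `P₀ ^ 2`; `F` restores their probability.
  have hpair (S) (hS : S ∈ s) (T) (hT : T ∈ s) :
      ∏ e ∈ pairs S ∪ pairs T, (1 - q e) = P₀ ^ 2 * F (S ∩ T) := by
    have h := Finset.prod_union_inter (s₁ := pairs S) (s₂ := pairs T) (f := fun e => 1 - q e)
    rw [hprodS S hS, hprodS T hT, pairs_inter,
      hprod _ (hsub S hS _ Finset.inter_subset_left).1] at h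
    rw [sq, ← h, mul_assoc, hF, ← Real.exp_add]
    simp
  have hinner (S) (hS : S ∈ s) :
      ∑ T ∈ s with ¬ Disjoint (pairs S) (pairs T), ∏ e ∈ pairs S ∪ pairs T, (1 - q e) ≤
        P₀ ^ 2 * (s.card * (δ * Real.exp 1)) := by
    set W := S.powerset.filter fun R => 2 ≤ R.card with hW
    calc _ = ∑ T ∈ s with ¬ Disjoint (pairs S) (pairs T), P₀ ^ 2 * F (S ∩ T) :=
          Finset.sum_congr rfl fun T hT => hpair S hS T (Finset.mem_filter.1 hT).1
      -- The term for `R = S ∩ T` is kept among all `R ⊆ S ∩ T` with at least two elements;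
      -- overcounting lets the sums be exchanged.
      _ ≤ ∑ T ∈ s with ¬ Disjoint (pairs S) (pairs T), ∑ R ∈ W with R ⊆ T, P₀ ^ 2 * F R := by
          refine Finset.sum_le_sum fun T hT => ?_
          refine Finset.single_le_sum (f := fun R => P₀ ^ 2 * F R)
            (fun R _ => by positivity) ?_
          have h2 := (Finset.mem_filter.1 hT).2
          rw [Finset.disjoint_iff_inter_eq_empty, pairs_inter, ← ne_eq,
            ← Finset.nonempty_iff_ne_empty, pairs_nonempty] at h2
          simp [hW, h2]
      _ ≤ ∑ T ∈ s, ∑ R ∈ W with R ⊆ T, P₀ ^ 2 * F R :=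
          Finset.sum_le_sum_of_subset_of_nonneg (Finset.filter_subset _ _) fun T _ _ =>
            Finset.sum_nonneg fun R _ => by positivity
      _ = ∑ R ∈ W, ∑ T ∈ s with R ⊆ T, P₀ ^ 2 * F R := by
          simp only [Finset.sum_filter]
          exact Finset.sum_comm
      _ ≤ ∑ R ∈ W, P₀ ^ 2 * (s.card * (δ * (1 / r) ^ R.card)) := by
          refine Finset.sum_le_sum fun R hR => ?_
          obtain ⟨hRS, hR2⟩ := Finset.mem_filter.1 hR
          obtain ⟨hRu, hRa, hRb⟩ := hsub S hS R (Finset.mem_powerset.1 hRS)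
          have hcard := card_eq_of_subset_union hAB hRu
          rw [Finset.sum_const, nsmul_eq_mul]
          have hc := card_profileSets_filter_superset_le hAB ha hb hr.le hm hrA hrB hRu hRa hRb
          have hd := hδ _ _ hRa hRb (by omega)
          rw [← hcard] at hd
          -- The first factor, together with `F R`, is absorbed by `δ`; the second makes the sum
          -- over `R ⊆ S` at most e.
          have hsplit : (r / m) ^ R.card = (r ^ 2 / m) ^ R.card * (1 / r) ^ R.card := by
            rw [← mul_pow]
            congr 1
            field_simp
          calc _ ≤ (s.card * (r / m) ^ R.card) * (P₀ ^ 2 * F R) := by gcongr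
            _ = P₀ ^ 2 * (s.card * (((r ^ 2 / m) ^ R.card * F R) * (1 / r) ^ R.card)) := by
              rw [hsplit]; ring
            _ ≤ _ := by gcongr
      _ ≤ ∑ R ∈ S.powerset, P₀ ^ 2 * (s.card * (δ * (1 / r) ^ R.card)) :=
          Finset.sum_le_sum_of_subset_of_nonneg (Finset.filter_subset _ _) fun R _ _ => by
            positivity
      _ ≤ _ := by
          rw [← Finset.mul_sum, ← Finset.mul_sum, ← Finset.mul_sum]
          gcongr
          refine sum_powerset_inv_pow_le S hr ?_
          rw [hScard S hS]
          exact_mod_cast hrab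
  have hcorr : avoidCorr q s pairs ≤ (s.card * P₀) ^ 2 * (δ * Real.exp 1) := by
    refine (Finset.sum_le_sum hinner).trans (le_of_eq ?_)
    rw [Finset.sum_const, nsmul_eq_mul]
    ring
  have hs0 : 0 < s.card := by
    rw [hs, card_profileSets hAB]
    exact Nat.mul_pos (Nat.choose_pos ha) (Nat.choose_pos hb)
  have hcorr0 : 0 < avoidCorr q s pairs := by
    have hnn (S T : Finset V) : 0 < ∏ e ∈ pairs S ∪ pairs T, (1 - q e) :=
      Finset.prod_pos fun e _ => by linarith [h1 e]
    refine Finset.sum_pos (fun S hS => Finset.sum_pos (fun T _ => hnn S T) ⟨S, ?_⟩)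
      (Finset.card_pos.1 hs0)
    refine Finset.mem_filter.2 ⟨hS, ?_⟩
    rw [disjoint_self, Finset.bot_eq_empty, ← ne_eq, ← Finset.nonempty_iff_ne_empty,
      pairs_nonempty, hScard S hS]
    exact hab
  have hjanson := subsetExp_meets_all_le (p := q) h0 h1 s pairs hcorr0
  refine le_trans (subsetExp_mono h0 h1 fun E => ?_) (hjanson.trans (Real.exp_le_exp.2 ?_))
  · split_ifs with hE hE' hE'
    · exact le_rfl
    · refine absurd (fun S hS => ?_) hE'
      obtain ⟨hS, hSa, hSb⟩ := (mem_profileSets hAB).1 hS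
      rw [← isIndepSet_fromEdgeSet_iff]
      exact hE S hS hSa hSb
    · exact zero_le_one
    · exact le_rfl
  · rw [neg_le_neg_iff, hmean, div_le_div_iff₀ (by positivity) (by positivity), one_mul]
    have he : Real.exp 1 ≤ 3 := by linarith [Real.exp_one_lt_d9]
    calc 2 * avoidCorr q s pairs ≤ 2 * ((s.card * P₀) ^ 2 * (δ * 3)) := by
          have : (s.card * P₀) ^ 2 * (δ * Real.exp 1) ≤ (s.card * P₀) ^ 2 * (δ * 3) := by gcongr
          linarith
      _ = _ := by ring

end Profile

end Probability

/-! ### Cost inequalities for sub-profiles -/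

section Numeric

/-- Here `s` counts vertices and `l` is their weight. For s ≥ 4/ε the gap between 2 - ε and 2 pays
for the extra 3L/2. For smaller `s` the weight is bounded, hence at most L/8, and s ≥ 2 suffices. -/
lemma profile_ineq_of_light {L K ε s l : ℝ} (hε : 0 < ε) (hε' : ε ≤ 1 / 2) (hs : 2 ≤ s)
    (hl0 : 0 ≤ l) (hlK : l ≤ K * s) (hl : l ≤ (2 - ε) * L) (hK : 0 ≤ K)
    (hL0 : 0 ≤ L) (hL : 32 * K / ε ≤ L) :
    (s - 1) / 2 * l + 3 / 2 * L ≤ s * ((1 - ε / 8) * L) := by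
  rw [div_le_iff₀ hε] at hL
  by_cases h : 4 ≤ s * ε
  · have h1 : s * l ≤ s * ((2 - ε) * L) := by gcongr
    have h2 : 4 * L ≤ s * ε * L := by gcongr
    linarith
  · have h1 : K * s * ε ≤ K * 4 := by
      rw [mul_assoc]
      exact mul_le_mul_of_nonneg_left (by linarith) hK
    have h2 : l * ε ≤ L / 8 * ε := by
      have := mul_le_mul_of_nonneg_right hlK hε.le
      linarith
    have h3 : l ≤ L / 8 := le_of_mul_le_mul_right h2 hε
    have h4 : s * l ≤ s * (L / 8) := by gcongr
    have h5 : 2 * L ≤ s * L := by gcongr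
    have h6 : ε * (s * L) ≤ 1 / 2 * (s * L) := by gcongr
    linarith

/-- A weight close to the maximum forces c₁u and c₂v both to be at least L/2. The saving d·u·v is
then of order L² and outweighs the excess of order ηL² caused by a weight up to (2 + η)L. -/
lemma profile_ineq_of_heavy {L c₁ c₂ d η u v : ℝ} (hc₁ : 0 < c₁) (hc₂ : 0 < c₂) (hd : 0 < d)
    (hη : 0 < η) (hη' : η ≤ 1 / 4) (hηd : η * (c₂ + 2 * c₁) ≤ d / 8)
    (hu0 : 0 ≤ u) (hv0 : 0 ≤ v) (hu : c₁ * u ≤ L) (hv : c₂ * v ≤ (1 + η) * L)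
    (hheavy : (2 - η) * L ≤ c₁ * u + c₂ * v) (hL0 : 0 ≤ L) (hL : 12 * (c₁ * c₂) / d ≤ L) :
    (u + v - 1) / 2 * (c₁ * u + c₂ * v) - d * (u * v) + 3 / 2 * L ≤
      (u + v) * ((1 - η / 8) * L) := by
  rw [div_le_iff₀ hd] at hL
  have hηL : η * L ≤ 1 / 4 * L := by gcongr
  have hu1 : L / 2 ≤ c₁ * u := by linarith
  have hv1 : L / 2 ≤ c₂ * v := by linarith
  have huv : L / 2 * (L / 2) ≤ c₁ * u * (c₂ * v) := by gcongr
  have hs : (c₁ * c₂) * (u + v) ≤ (c₂ + 2 * c₁) * L := by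
    have h1 : c₂ * (c₁ * u) ≤ c₂ * L := by gcongr
    have h2 : c₁ * (c₂ * v) ≤ c₁ * ((1 + η) * L) := by gcongr
    have h3 : c₁ * ((1 + η) * L) ≤ c₁ * (2 * L) := by gcongr; linarith
    linarith
  have h1 : (u + v) * (c₁ * u + c₂ * v) ≤ (u + v) * ((2 + η) * L) := by
    gcongr
    linarith
  have hcost : (u + v - 1) / 2 * (c₁ * u + c₂ * v) ≤ (u + v) * ((1 + η / 2) * L) := by
    have : 0 ≤ c₁ * u + c₂ * v := by positivity
    linarith
  have hcc : 0 < c₁ * c₂ := by positivity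
  suffices h : (c₁ * c₂) * ((u + v) * (η * L) + 3 / 2 * L) ≤ (c₁ * c₂) * (d * (u * v)) by
    have h' := le_of_mul_le_mul_left h hcc
    have : 0 ≤ (u + v) * (η * L) := by positivity
    linarith
  have h2 : (c₁ * c₂) * (u + v) * (η * L) ≤ (c₂ + 2 * c₁) * L * (η * L) := by gcongr
  have h3 : η * (c₂ + 2 * c₁) * L ^ 2 ≤ d / 8 * L ^ 2 := by gcongr
  have h4 : 12 * (c₁ * c₂) * L ≤ L * d * L := by gcongr
  have h5 := mul_le_mul_of_nonneg_left huv hd.le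
  linarith

/-- Separates the cost at the threshold c₁₂ = (c₁ + c₂)/2 from the saving on the `u * v` cross
pairs. -/
lemma profileCost_eq (c₁ c₂ c₁₂ : ℝ) (u v : ℕ) : profileCost c₁ c₂ c₁₂ u v =
    ((u + v : ℝ) - 1) / 2 * (c₁ * u + c₂ * v) - ((c₁ + c₂) / 2 - c₁₂) * (u * v) := by
  unfold profileCost
  ring

lemma tendsto_log_natCast : Tendsto (fun n : ℕ => Real.log n) atTop atTop :=
  Real.tendsto_log_atTop.comp tendsto_natCast_atTop_atTop

lemma eventually_mul_pow_le_exp (C : ℝ) {τ : ℝ} (hτ : 0 < τ) (k : ℕ) :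
    ∀ᶠ L : ℝ in atTop, C * L ^ k ≤ Real.exp (τ * L) := by
  have h := (tendsto_rpow_mul_exp_neg_mul_atTop_nhds_zero (k : ℝ) τ hτ).const_mul C
  rw [mul_zero] at h
  filter_upwards [h.eventually (gt_mem_nhds zero_lt_one)] with L hL
  rw [neg_mul, Real.exp_neg, Real.rpow_natCast, ← mul_assoc, ← div_eq_mul_inv,
    div_lt_one (Real.exp_pos _)] at hL
  exact hL.le

/-- The size from which on the random graph has no exceptional vertex sets. -/
def bulkSize (n : ℕ) : ℝ := n / Real.log n ^ 2

lemma eventually_bulkSize (C : ℝ) : ∀ᶠ n : ℕ in atTop, C * Real.log n ≤ bulkSize n := by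
  filter_upwards [tendsto_log_natCast.eventually (eventually_mul_pow_le_exp C zero_lt_one 3),
    tendsto_log_natCast.eventually_gt_atTop 0, eventually_gt_atTop 0] with n h hL hn
  rw [one_mul, Real.exp_log (by exact_mod_cast hn)] at h
  rw [bulkSize, le_div_iff₀ (by positivity)]
  linarith

end Numeric

/-! ### Profiles in all large vertex sets at once -/

/-- All large subsets of `X` and `Y` contain an independent set with `a` vertices in the first one
and `b` in the second one. -/
def HasProfileSets {V : Type*} [DecidableEq V] (G : SimpleGraph V) (X Y : Finset V) (m : ℝ)
    (a b : ℕ) : Prop :=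
  ∀ A ⊆ X, ∀ B ⊆ Y, m ≤ A.card → (0 < b → m ≤ B.card) →
    ∃ S ⊆ A ∪ B, (S ∩ A).card = a ∧ (S ∩ B).card = b ∧ G.IsIndepSet S

section Union

variable {V : Type*} [Fintype V] [DecidableEq V]

/-- Union bound over at most 2ⁿ · 2ⁿ pairs of subsets; the Janson bound is uniform because `δ` does
not depend on them. -/
theorem not_hasProfileSets_le (p : Sym2 V → I) (h1 : ∀ e, (p e : ℝ) < 1)
    {X Y : Finset V} (hXY : Disjoint X Y) {c₁ c₂ c₁₂ : ℝ}
    (h₁ : ∀ x ∈ X, ∀ y ∈ X, x ≠ y → -Real.log (1 - p s(x, y)) = c₁)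
    (h₂ : ∀ x ∈ Y, ∀ y ∈ Y, x ≠ y → -Real.log (1 - p s(x, y)) = c₂)
    (h₁₂ : ∀ x ∈ X, ∀ y ∈ Y, -Real.log (1 - p s(x, y)) = c₁₂) {n a b : ℕ}
    (hV : Fintype.card V ≤ n) (hab : 2 ≤ a + b) {r m δ : ℝ} (hm : 0 < m)
    (hrab : (a + b : ℝ) ≤ r) (ham : (a : ℝ) ≤ m) (hbm : (b : ℝ) ≤ m)
    (hδ0 : 0 < δ) (hδ : ∀ u v : ℕ, u ≤ a → v ≤ b → 2 ≤ u + v →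
      (r ^ 2 / m) ^ (u + v) * Real.exp (profileCost c₁ c₂ c₁₂ u v) ≤ δ) :
    independentEdges V p {G | ¬ HasProfileSets G X Y m a b} ≤
      ENNReal.ofReal (4 ^ n * Real.exp (-(1 / (6 * δ)))) := by
  classical
  set D : Finset (Finset V × Finset V) := (X.powerset ×ˢ Y.powerset).filter
    fun D => m ≤ D.1.card ∧ (0 < b → m ≤ D.2.card) with hD
  have hsub : {G : SimpleGraph V | ¬ HasProfileSets G X Y m a b} ⊆
      ⋃ AB ∈ D, {G | ∀ S : Finset V, S ⊆ AB.1 ∪ AB.2 → (S ∩ AB.1).card = a →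
        (S ∩ AB.2).card = b → ¬ G.IsIndepSet S} := by
    intro G hG
    simp only [HasProfileSets, Set.mem_ofPred_eq, not_forall] at hG
    obtain ⟨A, hA, B, hB, hmA, hmB, h⟩ := hG
    refine Set.mem_biUnion (x := (A, B)) ?_ fun S hS ha hb hI => h ⟨S, hS, ha, hb, hI⟩
    simp [hD, hA, hB, hmA]
    exact hmB
  have hr0 : 0 ≤ r := le_trans (by positivity) hrab
  have har : (a : ℝ) ≤ r := by linarith [Nat.cast_nonneg (α := ℝ) b]
  have hbr : (b : ℝ) ≤ r := by linarith [Nat.cast_nonneg (α := ℝ) a]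
  calc _ ≤ ∑ AB ∈ D, independentEdges V p {G | ∀ S : Finset V, S ⊆ AB.1 ∪ AB.2 →
        (S ∩ AB.1).card = a → (S ∩ AB.2).card = b → ¬ G.IsIndepSet S} :=
      (measure_mono hsub).trans (measure_biUnion_finset_le _ _)
    _ ≤ ∑ AB ∈ D, ENNReal.ofReal (Real.exp (-(1 / (6 * δ)))) := by
      refine Finset.sum_le_sum fun AB hAB => ?_
      simp only [hD, Finset.mem_filter, Finset.mem_product, Finset.mem_powerset] at hAB
      obtain ⟨⟨hA, hB⟩, hmA, hmB⟩ := hAB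
      have hb : b ≤ AB.2.card ∧ b * m ≤ r * AB.2.card := by
        rcases Nat.eq_zero_or_pos b with rfl | hb
        · simp only [Nat.zero_le, Nat.cast_zero, zero_mul, true_and]
          positivity
        · refine ⟨by exact_mod_cast hbm.trans (hmB hb), ?_⟩
          gcongr
          exact hmB hb
      exact no_profile_isIndepSet_le p h1 (hXY.mono hA hB)
        (fun x hx y hy => h₁ x (hA hx) y (hA hy)) (fun x hx y hy => h₂ x (hB hx) y (hB hy))
        (fun x hx y hy => h₁₂ x (hA hx) y (hB hy)) (by exact_mod_cast ham.trans hmA) hb.1 hab hm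
        hrab (by gcongr) hb.2 hδ0 hδ
    _ ≤ _ := by
      rw [Finset.sum_const, nsmul_eq_mul, ENNReal.ofReal_mul (by positivity)]
      gcongr
      have hcard : D.card ≤ 4 ^ n := by
        calc D.card ≤ (X.powerset ×ˢ Y.powerset).card := Finset.card_filter_le _ _
          _ = 2 ^ X.card * 2 ^ Y.card := by
            rw [Finset.card_product, Finset.card_powerset, Finset.card_powerset]
          _ ≤ 2 ^ n * 2 ^ n := by
            gcongr
            · norm_num
            · exact (Finset.card_le_univ X).trans hV
            · norm_num
            · exact (Finset.card_le_univ Y).trans hV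
          _ = 4 ^ n := by rw [← mul_pow]; norm_num
      rw [show (4 : ℝ) ^ n = ((4 ^ n : ℕ) : ℝ) by push_cast; rfl, ENNReal.ofReal_natCast]
      exact_mod_cast hcard

end Union

/-- If the profile inequality holds at the scale `log n`, then with high probability all pairs of
large sets contain an independent set of the given profile. -/
theorem eventually_not_hasProfileSets_le {c₁ c₂ c₁₂ C τ : ℝ} (hC : 0 < C) (hτ : 0 < τ)
    (a b : ℕ → ℕ) (hab2 : ∀ᶠ n in atTop, 2 ≤ a n + b n)
    (hab : ∀ᶠ n in atTop, (a n + b n : ℝ) ≤ C * Real.log n)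
    (hcost : ∀ᶠ n in atTop, ∀ u v : ℕ, u ≤ a n → v ≤ b n → 2 ≤ u + v →
      profileCost c₁ c₂ c₁₂ u v + 3 / 2 * Real.log n ≤ (u + v) * ((1 - τ) * Real.log n)) :
    ∀ᶠ n in atTop, ∀ (V : Type) [Fintype V] [DecidableEq V] (p : Sym2 V → I) (X Y : Finset V),
      Fintype.card V ≤ n → (∀ e, (p e : ℝ) < 1) → Disjoint X Y →
      (∀ x ∈ X, ∀ y ∈ X, x ≠ y → -Real.log (1 - p s(x, y)) = c₁) →
      (∀ x ∈ Y, ∀ y ∈ Y, x ≠ y → -Real.log (1 - p s(x, y)) = c₂) →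
      (∀ x ∈ X, ∀ y ∈ Y, -Real.log (1 - p s(x, y)) = c₁₂) →
      independentEdges V p {G | ¬ HasProfileSets G X Y (bulkSize n) (a n) (b n)} ≤
        ENNReal.ofReal (Real.exp (-n)) := by
  filter_upwards [hab2, hab, hcost, eventually_bulkSize C, eventually_gt_atTop 0,
    tendsto_log_natCast.eventually (eventually_mul_pow_le_exp (C ^ 2) hτ 4),
    tendsto_log_natCast.eventually (eventually_mul_pow_le_exp 18 one_half_pos 0),
    tendsto_log_natCast.eventually_gt_atTop 0] with n hab2 hab hcost hbulk hn hexp h18 hL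
  intro V _ _ p X Y hV hp1 hXY h₁ h₂ h₁₂
  set L := Real.log n with hLdef
  have hn' : (0 : ℝ) < n := by exact_mod_cast hn
  have hnL : Real.exp L = n := Real.exp_log hn'
  have hm : 0 < bulkSize n := by rw [bulkSize]; positivity
  have ha : (a n : ℝ) ≤ bulkSize n := by linarith [Nat.cast_nonneg (α := ℝ) (b n)]
  have hb : (b n : ℝ) ≤ bulkSize n := by linarith [Nat.cast_nonneg (α := ℝ) (a n)]
  -- The left side is C² log⁴ n / n, and n^τ absorbs the logarithms.
  have hratio : (C * L) ^ 2 / bulkSize n ≤ Real.exp (-((1 - τ) * L)) := by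
    have e1 : -((1 - τ) * L) = τ * L - L := by ring
    rw [e1, Real.exp_sub, hnL, bulkSize, ← hLdef, div_div_eq_mul_div]
    gcongr
    linarith
  -- With δ = n^(-3/2) the Janson exponent is n^(3/2)/6, at least 3n once √n ≥ 18; and 4 ≤ e² leaves
  -- exp(-n).
  refine (not_hasProfileSets_le p hp1 hXY h₁ h₂ h₁₂ hV hab2 (r := C * L) (m := bulkSize n)
    (δ := Real.exp (-(3 / 2 * L))) hm hab ha hb (Real.exp_pos _) ?_).trans
      (ENNReal.ofReal_le_ofReal ?_)
  · intro u v hu hv huv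
    calc _ ≤ Real.exp (-((1 - τ) * L)) ^ (u + v) * Real.exp (profileCost c₁ c₂ c₁₂ u v) := by
          gcongr
      _ = Real.exp (((u + v : ℕ) : ℝ) * (-((1 - τ) * L)) + profileCost c₁ c₂ c₁₂ u v) := by
          rw [← Real.exp_nat_mul, ← Real.exp_add]
      _ ≤ _ := by
          refine Real.exp_le_exp.2 ?_
          have := hcost u v hu hv huv
          push_cast
          linarith
  · have h4 : (4 : ℝ) ≤ Real.exp 2 := by
      have : (2 : ℝ) ≤ Real.exp 1 := by linarith [Real.add_one_le_exp 1]
      calc (4 : ℝ) = 2 * 2 := by norm_num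
        _ ≤ Real.exp 1 * Real.exp 1 := by gcongr
        _ = Real.exp 2 := by rw [← Real.exp_add]; norm_num
    have h3n : 3 * (n : ℝ) ≤ 1 / (6 * Real.exp (-(3 / 2 * L))) := by
      have e2 : 1 / (6 * Real.exp (-(3 / 2 * L))) = Real.exp (1 / 2 * L) * n / 6 := by
        rw [← hnL, ← Real.exp_add, Real.exp_neg]
        have : 1 / 2 * L + L = 3 / 2 * L := by ring
        rw [this]
        field_simp
      rw [e2]
      have := mul_le_mul_of_nonneg_right h18 hn'.le
      rw [pow_zero, mul_one] at this
      linarith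
    calc (4 : ℝ) ^ n * Real.exp (-(1 / (6 * Real.exp (-(3 / 2 * L)))))
        ≤ Real.exp 2 ^ n * Real.exp (-(3 * n)) := by
          gcongr
      _ = Real.exp (-n) := by
          rw [← Real.exp_nat_mul, ← Real.exp_add]
          congr 1
          ring

/-- The size of the independent sets used in a single part of pair cost `c`. -/
def soloSize (ε c : ℝ) (n : ℕ) : ℕ := ⌊(2 - ε) * Real.log n / c⌋₊

/-- The one-part case is the degenerate profile `b = 0` with `Y = ∅`, so the costs `c₂` and `c₁₂`
are immaterial. Every sub-profile is light. -/
theorem eventually_not_hasSoloSets_le {c ε : ℝ} (hc : 0 < c) (hε : 0 < ε) (hε' : ε ≤ 1 / 2) :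
    ∀ᶠ n in atTop, ∀ (V : Type) [Fintype V] [DecidableEq V] (p : Sym2 V → I) (X : Finset V),
      Fintype.card V ≤ n → (∀ e, (p e : ℝ) < 1) →
      (∀ x ∈ X, ∀ y ∈ X, x ≠ y → -Real.log (1 - p s(x, y)) = c) →
      independentEdges V p {G | ¬ HasProfileSets G X ∅ (bulkSize n) (soloSize ε c n) 0} ≤
        ENNReal.ofReal (Real.exp (-n)) := by
  have hfloor (n : ℕ) : (soloSize ε c n : ℝ) ≤ (2 - ε) * Real.log n / c :=
    Nat.floor_le (div_nonneg (mul_nonneg (by linarith) (Real.log_natCast_nonneg n)) hc.le)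
  have h := eventually_not_hasProfileSets_le (c₁ := c) (c₂ := 0) (c₁₂ := 0) (C := 2 / c)
    (τ := ε / 8) (by positivity) (by positivity) (soloSize ε c) (fun _ => 0) ?_ ?_ ?_
  · filter_upwards [h] with n h V _ _ p X hV hp hX
    exact h V p X ∅ hV hp (Finset.disjoint_empty_right X) hX (by simp) (by simp)
  · filter_upwards [tendsto_log_natCast.eventually_ge_atTop (2 * c)] with n hn
    refine (Nat.le_floor ?_ : 2 ≤ soloSize ε c n)
    rw [le_div_iff₀ hc]
    push_cast
    nlinarith
  · filter_upwards with n
    have : (2 - ε) * Real.log n / c ≤ 2 / c * Real.log n := by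
      rw [div_mul_eq_mul_div]
      have := Real.log_natCast_nonneg n
      gcongr
      linarith
    simpa using (hfloor n).trans this
  · filter_upwards [tendsto_log_natCast.eventually_ge_atTop (32 * c / ε)] with n hn u v hu hv huv
    obtain rfl : v = 0 := by omega
    have hu' : (u : ℝ) ≤ (2 - ε) * Real.log n / c := le_trans (by exact_mod_cast hu) (hfloor n)
    rw [le_div_iff₀ hc] at hu'
    have := profile_ineq_of_light (s := u) (l := c * u) hε hε'
      (by exact_mod_cast (by omega : 2 ≤ u)) (by positivity) le_rfl (by linarith) hc.le
      (Real.log_natCast_nonneg n) hn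
    rw [profileCost_eq]
    simpa using this

theorem eventually_not_hasMixedSets_le {c₁ c₂ c₁₂ : ℝ} (hc₁ : 0 < c₁) (hc₂ : 0 < c₂)
    (hc₁₂ : c₁₂ < (c₁ + c₂) / 2) :
    ∃ η > 0, ∀ᶠ n in atTop, ∀ (V : Type) [Fintype V] [DecidableEq V] (p : Sym2 V → I)
      (X Y : Finset V), Fintype.card V ≤ n → (∀ e, (p e : ℝ) < 1) → Disjoint X Y →
      (∀ x ∈ X, ∀ y ∈ X, x ≠ y → -Real.log (1 - p s(x, y)) = c₁) →
      (∀ x ∈ Y, ∀ y ∈ Y, x ≠ y → -Real.log (1 - p s(x, y)) = c₂) →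
      (∀ x ∈ X, ∀ y ∈ Y, -Real.log (1 - p s(x, y)) = c₁₂) →
      independentEdges V p {G | ¬ HasProfileSets G X Y (bulkSize n) ⌊Real.log n / c₁⌋₊
        ⌊(1 + η) * Real.log n / c₂⌋₊} ≤ ENNReal.ofReal (Real.exp (-n)) := by
  set d := (c₁ + c₂) / 2 - c₁₂ with hd
  have hd0 : 0 < d := by linarith
  -- The second bound keeps the excess ηL² below the saving from cross pairs in
  -- `profile_ineq_of_heavy`.
  set η := min (1 / 4) (d / 8 / (c₂ + 2 * c₁)) with hη
  have hη0 : 0 < η := by positivity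
  have hη1 : η ≤ 1 / 4 := min_le_left _ _
  have hηd : η * (c₂ + 2 * c₁) ≤ d / 8 :=
    (le_div_iff₀ (by positivity)).1 (min_le_right _ _)
  have hfa (n : ℕ) : (⌊Real.log n / c₁⌋₊ : ℝ) ≤ Real.log n / c₁ :=
    Nat.floor_le (div_nonneg (Real.log_natCast_nonneg n) hc₁.le)
  have hfb (n : ℕ) : (⌊(1 + η) * Real.log n / c₂⌋₊ : ℝ) ≤ (1 + η) * Real.log n / c₂ :=
    Nat.floor_le (div_nonneg (mul_nonneg (by linarith) (Real.log_natCast_nonneg n)) hc₂.le)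
  refine ⟨η, hη0, eventually_not_hasProfileSets_le (C := 1 / c₁ + 2 / c₂) (τ := η / 8)
    (by positivity) (by positivity) _ _ ?_ ?_ ?_⟩
  · filter_upwards [tendsto_log_natCast.eventually_ge_atTop (2 * c₁)] with n hn
    refine le_trans (Nat.le_floor ?_) (Nat.le_add_right _ _)
    rw [le_div_iff₀ hc₁]
    exact_mod_cast hn
  · filter_upwards with n
    have h0 := Real.log_natCast_nonneg n
    have h2 : (1 + η) * Real.log n / c₂ ≤ 2 * Real.log n / c₂ := by gcongr; linarith
    calc _ ≤ Real.log n / c₁ + 2 * Real.log n / c₂ := add_le_add (hfa n) ((hfb n).trans h2)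
      _ = _ := by ring
  · filter_upwards [tendsto_log_natCast.eventually_ge_atTop (32 * (c₁ + c₂) / η),
      tendsto_log_natCast.eventually_ge_atTop (12 * (c₁ * c₂) / d)] with n hn1 hn2 u v hu hv huv
    have h0 := Real.log_natCast_nonneg n
    have hu' : (u : ℝ) ≤ Real.log n / c₁ := le_trans (by exact_mod_cast hu) (hfa n)
    have hv' : (v : ℝ) ≤ (1 + η) * Real.log n / c₂ := le_trans (by exact_mod_cast hv) (hfb n)
    rw [le_div_iff₀ hc₁] at hu'
    rw [le_div_iff₀ hc₂] at hv'
    rw [profileCost_eq, ← hd]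
    have huv' : (2 : ℝ) ≤ u + v := by exact_mod_cast huv
    -- Light sub-profiles do not need the cheap cross pairs; those near the full profile do.
    by_cases hl : c₁ * u + c₂ * v ≤ (2 - η) * Real.log n
    · have := profile_ineq_of_light (s := u + v) (l := c₁ * u + c₂ * v) (K := c₁ + c₂) hη0
        (by linarith) huv' (by positivity) (by
          have : 0 ≤ c₁ * v + c₂ * u := by positivity
          linarith) hl (by positivity) h0 hn1
      have : 0 ≤ d * (u * v) := by positivity
      linarith
    · exact profile_ineq_of_heavy hc₁ hc₂ hd0 hη0 hη1 hηd (by positivity) (by positivity)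
        (by linarith) (by linarith) (by linarith) h0 hn2

/-! ### Weights of colour classes and greedy colouring -/

section Coloring

variable {V : Type*} {G : SimpleGraph V}

/-- The graph induced by `G` on `U` has a proper colouring with `t` colours. -/
def ColorableOn (G : SimpleGraph V) (U : Finset V) (t : ℕ) : Prop :=
  ∃ f : V → ℕ, (∀ v ∈ U, f v < t) ∧ ∀ u ∈ U, ∀ v ∈ U, G.Adj u v → f u ≠ f v

lemma ColorableOn.union [DecidableEq V] {U W : Finset V} {s t : ℕ} (hU : ColorableOn G U s)
    (hW : ColorableOn G W t) : ColorableOn G (U ∪ W) (s + t) := by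
  obtain ⟨f, hf, hf'⟩ := hU
  obtain ⟨g, hg, hg'⟩ := hW
  refine ⟨fun v => if v ∈ U then f v else s + g v, fun v hv => ?_, fun u hu v hv huv => ?_⟩
  · by_cases h : v ∈ U
    · simpa [h] using (hf v h).trans_le (Nat.le_add_right s t)
    · simpa [h] using hg v ((Finset.mem_union.1 hv).resolve_left h)
  · by_cases h1 : u ∈ U <;> by_cases h2 : v ∈ U <;> simp only [h1, h2, if_true, if_false]
    · exact hf' u h1 v h2 huv
    · have := hf u h1
      omega
    · have := hf v h2
      omega
    · have := hg' u ((Finset.mem_union.1 hu).resolve_left h1) v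
        ((Finset.mem_union.1 hv).resolve_left h2) huv
      omega

lemma colorableOn_empty : ColorableOn G ∅ 0 := ⟨fun _ => 0, by simp, by simp⟩

lemma colorableOn_card (U : Finset V) : ColorableOn G U U.card := by
  classical
  induction U using Finset.induction_on with
  | empty => exact colorableOn_empty
  | insert v U hv ih =>
    rw [Finset.card_insert_of_notMem hv, Finset.insert_eq, add_comm]
    refine ColorableOn.union ⟨fun _ => 0, by simp, ?_⟩ ih
    simp

lemma colorableOn_of_isIndepSet {S : Finset V} (hS : G.IsIndepSet S) : ColorableOn G S 1 :=
  ⟨fun _ => 0, by simp, fun u hu v hv huv => absurd huv (hS hu hv huv.ne)⟩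

lemma chi_le_of_colorableOn [Fintype V] {t : ℕ} (h : ColorableOn G Finset.univ t) :
    chi G ≤ t := by
  obtain ⟨f, hf, hf'⟩ := h
  have hc : G.Colorable t := ⟨SimpleGraph.Coloring.mk (fun v => ⟨f v, hf v (Finset.mem_univ v)⟩)
    fun {u v} huv h => hf' u (Finset.mem_univ u) v (Finset.mem_univ v) huv (Fin.mk.inj_iff.1 h)⟩
  rw [chi]
  exact_mod_cast ENat.toNat_le_of_le_natCast hc.chromaticNumber_le

/-- The classes of an optimal colouring are independent and partition the total weight. -/
lemma sum_le_chi_mul [Fintype V] (κ : V → ℝ) {θ : ℝ}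
    (h : ∀ S : Finset V, G.IsIndepSet S → ∑ x ∈ S, κ x ≤ θ) : ∑ x, κ x ≤ chi G * θ := by
  classical
  have hcol : G.Colorable G.chromaticNumber.toNat :=
    SimpleGraph.colorable_chromaticNumber G.colorable_of_fintype
  obtain ⟨C⟩ := hcol
  rw [← Finset.sum_fiberwise Finset.univ C κ]
  refine (Finset.sum_le_card_nsmul _ _ θ fun c _ => h _ ?_).trans ?_
  · intro x hx y hy _ hxy
    simp only [Finset.coe_filter, Finset.mem_univ, true_and, Set.mem_ofPred_eq] at hx hy
    exact C.valid hxy (hx.trans hy.symm)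
  · simp [chi]

variable [DecidableEq V]

/-- Remove independent sets of size `a` while at least `m` vertices remain, then give each remaining
vertex its own colour. -/
lemma HasProfileSets.exists_colorableOn {X : Finset V} {m : ℝ} {a : ℕ} (ha : 0 < a)
    (h : HasProfileSets G X ∅ m a 0) {U : Finset V} (hU : U ⊆ X) :
    ∃ t : ℕ, ColorableOn G U t ∧ (t : ℝ) ≤ U.card / a + m := by
  induction U using Finset.strongInduction with
  | H U ih =>
    by_cases hUm : m ≤ U.card
    · obtain ⟨S, hS, hSa, -, hI⟩ := h U hU ∅ le_rfl hUm (by simp)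
      rw [Finset.union_empty] at hS
      rw [Finset.inter_eq_left.2 hS] at hSa
      have hSne : S.Nonempty := Finset.card_pos.1 (by omega)
      obtain ⟨t, ht, htm⟩ := ih (U \ S) (Finset.sdiff_ssubset hS hSne)
        (Finset.sdiff_subset.trans hU)
      refine ⟨t + 1, ?_, ?_⟩
      · have := ht.union (colorableOn_of_isIndepSet hI)
        rwa [Finset.sdiff_union_of_subset hS] at this
      · have hcard : (U.card : ℝ) = (U \ S).card + a := by
          rw [← hSa]
          exact_mod_cast (Finset.card_sdiff_add_card_eq_card hS).symm
        have ha' : (0 : ℝ) < a := by exact_mod_cast ha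
        rw [hcard, add_div, div_self ha'.ne']
        push_cast
        linarith
    · refine ⟨U.card, colorableOn_card U, ?_⟩
      have : (0 : ℝ) ≤ U.card / a := by positivity
      linarith

/-- `T` greedy rounds with mixed sets; the size hypotheses keep both sides above `m` before each
round. -/
lemma HasProfileSets.exists_colorableOn_sdiff {X Y : Finset V} (hXY : Disjoint X Y) {m : ℝ}
    {a b : ℕ} (h : HasProfileSets G X Y m a b) (T : ℕ) (hX : m + a * T ≤ X.card)
    (hY : m + b * T ≤ Y.card) :
    ∃ X' ⊆ X, ∃ Y' ⊆ Y, (X'.card : ℝ) = X.card - a * T ∧ (Y'.card : ℝ) = Y.card - b * T ∧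
      ColorableOn G ((X \ X') ∪ (Y \ Y')) T := by
  induction T with
  | zero => exact ⟨X, le_rfl, Y, le_rfl, by simp, by simp, by simpa using colorableOn_empty⟩
  | succ T ih =>
    push_cast at hX hY
    have ha0 : (0 : ℝ) ≤ a := Nat.cast_nonneg a
    have hb0 : (0 : ℝ) ≤ b := Nat.cast_nonneg b
    obtain ⟨X', hX', Y', hY', hXc, hYc, hcol⟩ := ih (by linarith) (by linarith)
    obtain ⟨S, hS, hSa, hSb, hI⟩ := h X' hX' Y' hY' (by linarith) (fun _ => by linarith)
    refine ⟨X' \ S, Finset.sdiff_subset.trans hX', Y' \ S, Finset.sdiff_subset.trans hY', ?_, ?_,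
      ?_⟩
    · have := Finset.card_sdiff_add_card_inter X' S
      rw [Finset.inter_comm, hSa] at this
      have : ((X' \ S).card : ℝ) + a = X'.card := by exact_mod_cast this
      push_cast
      linarith
    · have := Finset.card_sdiff_add_card_inter Y' S
      rw [Finset.inter_comm, hSb] at this
      have : ((Y' \ S).card : ℝ) + b = Y'.card := by exact_mod_cast this
      push_cast
      linarith
    · have hu := hcol.union (colorableOn_of_isIndepSet hI)
      convert hu using 1
      ext x
      have h1 := @hX' x
      have h2 := @hY' x
      have h3 := @hS x
      simp only [Finset.mem_union, Finset.mem_sdiff] at h3 ⊢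
      have h4 : x ∈ X → x ∉ Y := fun hx => Finset.disjoint_left.1 hXY hx
      tauto

lemma exists_colorableOn_biUnion {ι : Type*} (s : Finset ι) (U : ι → Finset V) (b : ι → ℝ)
    (h : ∀ i ∈ s, ∃ t : ℕ, ColorableOn G (U i) t ∧ (t : ℝ) ≤ b i) :
    ∃ t : ℕ, ColorableOn G (s.biUnion U) t ∧ (t : ℝ) ≤ ∑ i ∈ s, b i := by
  classical
  induction s using Finset.induction_on with
  | empty => exact ⟨0, by simpa using colorableOn_empty, by simp⟩
  | insert i s hi ih =>
    obtain ⟨t, ht, htb⟩ := ih fun j hj => h j (Finset.mem_insert_of_mem hj)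
    obtain ⟨t', ht', htb'⟩ := h i (Finset.mem_insert_self i s)
    refine ⟨t' + t, ?_, ?_⟩
    · rw [Finset.biUnion_insert]
      exact ht'.union ht
    · rw [Finset.sum_insert hi]
      push_cast
      linarith

end Coloring

/-! ### Limits on the scale n/log n -/

lemma exists_add_div_two_sub_lt {A B ρ : ℝ} (h : A + B / 2 < ρ) :
    ∃ ε : ℝ, 0 < ε ∧ ε ≤ 1 / 2 ∧ A + B / (2 - ε) < ρ := by
  have hc : ContinuousAt (fun ε : ℝ => A + B / (2 - ε)) 0 :=
    continuousAt_const.add (continuousAt_const.div (continuousAt_const.sub continuousAt_id)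
      (by norm_num))
  have h0 : ∀ᶠ ε : ℝ in 𝓝[>] 0, A + B / (2 - ε) < ρ :=
    nhdsWithin_le_nhds (hc.eventually (gt_mem_nhds (by simpa using h)))
  have h1 : ∀ᶠ ε : ℝ in 𝓝[>] 0, ε ≤ 1 / 2 :=
    nhdsWithin_le_nhds (Iic_mem_nhds (by norm_num))
  obtain ⟨ε, hε, hε1, hε0⟩ :=
    (h0.and (h1.and (self_mem_nhdsWithin (a := (0 : ℝ)) (s := Set.Ioi 0)))).exists
  exact ⟨ε, hε0, hε1, hε⟩

lemma tendsto_floor_mul_log_div {x : ℝ} (hx : 0 ≤ x) :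
    Tendsto (fun n : ℕ => (⌊x * Real.log n⌋₊ : ℝ) / Real.log n) atTop (𝓝 x) :=
  (tendsto_nat_floor_mul_div_atTop hx).comp tendsto_log_natCast

lemma tendsto_bulkSize : Tendsto (fun n : ℕ => bulkSize n * Real.log n / n) atTop (𝓝 0) := by
  refine (tendsto_inv_atTop_zero.comp tendsto_log_natCast).congr' ?_
  filter_upwards [eventually_gt_atTop 0, tendsto_log_natCast.eventually_gt_atTop 0] with n hn hL
  have : (n : ℝ) ≠ 0 := by positivity
  simp only [Function.comp, bulkSize]
  field_simp

lemma tendsto_soloSize {ε c : ℝ} (hc : 0 < c) (hε : ε ≤ 1 / 2) :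
    Tendsto (fun n => (soloSize ε c n : ℝ) / Real.log n) atTop (𝓝 ((2 - ε) / c)) := by
  have h := tendsto_floor_mul_log_div (x := (2 - ε) / c) (div_nonneg (by linarith) hc.le)
  simpa only [soloSize, div_mul_eq_mul_div] using h

/-- The number of colours spent by the greedy colouring of cells of sizes `f i n`, in units of n/log
n; the leftover vertices vanish in the limit. -/
lemma tendsto_sum_soloSize {ι : Type*} [Fintype ι] {c β : ι → ℝ} (hc : ∀ i, 0 < c i) {ε : ℝ}
    (hε : ε ≤ 1 / 2) {f : ι → ℕ → ℝ} (hf : ∀ i, Tendsto (fun n => f i n / n) atTop (𝓝 (β i))) :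
    Tendsto (fun n : ℕ => (∑ i, (f i n / soloSize ε (c i) n + bulkSize n)) * Real.log n / n)
      atTop (𝓝 ((∑ i, β i * c i) / (2 - ε))) := by
  have h (i : ι) : Tendsto (fun n : ℕ => f i n / n / (soloSize ε (c i) n / Real.log n) +
      bulkSize n * Real.log n / n) atTop (𝓝 (β i / ((2 - ε) / c i) + 0)) :=
    ((hf i).div (tendsto_soloSize (hc i) hε)
      (div_pos (by linarith) (hc i)).ne').add tendsto_bulkSize
  have hsum := tendsto_finsetSum Finset.univ fun i (_ : i ∈ Finset.univ) => h i
  have hlim : ∑ i, (β i / ((2 - ε) / c i) + 0) = (∑ i, β i * c i) / (2 - ε) := by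
    rw [Finset.sum_div]
    exact Finset.sum_congr rfl fun i _ => by rw [add_zero, div_div_eq_mul_div]
  rw [hlim] at hsum
  refine hsum.congr fun n => ?_
  rw [Finset.sum_mul, Finset.sum_div]
  refine Finset.sum_congr rfl fun i _ => ?_
  rw [add_mul, add_div, div_div_div_eq, div_mul_eq_mul_div, div_div, mul_comm (n : ℝ)]

lemma le_mul_div_of_mul_div_le {x ρ l n : ℝ} (hl : 0 < l) (hn : 0 < n) (h : x * l / n ≤ ρ) :
    x ≤ ρ * (n / l) := by
  rw [div_le_iff₀ hn] at h
  rw [mul_div_assoc', le_div_iff₀ hl]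
  exact h

lemma tendsto_card_mul_exp_neg (N : ℕ) :
    Tendsto (fun n : ℕ => (N : ENNReal) * ENNReal.ofReal (Real.exp (-n))) atTop (𝓝 0) := by
  have h : Tendsto (fun n : ℕ => ENNReal.ofReal (Real.exp (-n))) atTop (𝓝 0) := by
    rw [← ENNReal.ofReal_zero]
    exact ENNReal.tendsto_ofReal
      (Real.tendsto_exp_neg_atTop_nhds_zero.comp tendsto_natCast_atTop_atTop)
  simpa using ENNReal.Tendsto.const_mul h (Or.inr (ENNReal.natCast_ne_top N))

/-! ### Asymptotic bounds for the chromatic number -/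

section Sequence

variable {V : ℕ → Type} [∀ n, Fintype (V n)] [∀ n, DecidableEq (V n)]

theorem tendsto_chi_lt (p : ∀ n, Sym2 (V n) → I) (hp : ∀ n e, (p n e : ℝ) < 1)
    (hV : ∀ n, Fintype.card (V n) ≤ n) (κ : ∀ n, V n → ℝ) {K s ρ : ℝ} (hK : 0 < K)
    (hκ : ∀ n x, κ n x ≤ K)
    (hpκ : ∀ n x y, x ≠ y → (κ n x + κ n y) / 2 ≤ -Real.log (1 - p n s(x, y)))
    (hs : Tendsto (fun n => (∑ x, κ n x) / n) atTop (𝓝 s)) (hρ0 : 0 ≤ ρ) (hρ : ρ < s / 2) :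
    Tendsto (fun n => independentEdges (V n) (p n) {G | ¬ ρ * (n / Real.log n) ≤ chi G})
      atTop (𝓝 0) := by
  obtain ⟨ε, hε, hερ⟩ : ∃ ε > 0, ρ * (2 + ε) < s := by
    refine ⟨(s - 2 * ρ) / (2 * (ρ + 1)), div_pos (by linarith) (by linarith), ?_⟩
    have : ρ * ((s - 2 * ρ) / (2 * (ρ + 1))) ≤ (s - 2 * ρ) / 2 := by
      rw [mul_div_assoc', div_le_div_iff₀ (by linarith) (by norm_num)]
      nlinarith
    linarith
  have hlim : Tendsto (fun n : ℕ => ENNReal.ofReal (Real.exp 1 / n)) atTop (𝓝 0) := by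
    rw [← ENNReal.ofReal_zero]
    exact ENNReal.tendsto_ofReal (tendsto_const_div_atTop_nhds_zero_nat _)
  have hlarge : Tendsto (fun n : ℕ => ε / 2 * ((2 + ε) * Real.log n / K - 1)) atTop atTop := by
    refine Tendsto.const_mul_atTop (by positivity) (tendsto_atTop_add_const_right _ _ ?_)
    exact (tendsto_log_natCast.const_mul_atTop (by positivity)).atTop_div_const hK
  refine tendsto_of_tendsto_of_tendsto_of_le_of_le' tendsto_const_nhds hlim
    (Eventually.of_forall fun _ => zero_le) ?_
  filter_upwards [hlarge.eventually_ge_atTop 2, eventually_gt_atTop 0,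
    tendsto_log_natCast.eventually_gt_atTop 0, hs.eventually (lt_mem_nhds hερ)]
    with n hn2 hn hL hsn
  have hn' : (0 : ℝ) < n := by exact_mod_cast hn
  refine (measure_mono ?_).trans (exists_heavy_isIndepSet_le (p n) (hp n) (κ n) hK (hκ n)
    (hpκ n) hn (hV n) hε hn2)
  intro G hG
  by_contra hno
  refine hG ?_
  simp only [Set.mem_ofPred_eq, not_exists, not_and, not_le] at hno
  have h := sum_le_chi_mul (κ n) fun S hS => (hno S hS).le
  rw [lt_div_iff₀ hn'] at hsn
  rw [mul_div_assoc', div_le_iff₀ hL]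
  refine le_of_mul_le_mul_right (a := 2 + ε) ?_ (by linarith)
  linarith

variable {ι : Type*} [Fintype ι]

/-- The cells get disjoint palettes, so edges between cells play no role. -/
theorem tendsto_lt_chi (p : ∀ n, Sym2 (V n) → I) (hp : ∀ n e, (p n e : ℝ) < 1)
    (hV : ∀ n, Fintype.card (V n) ≤ n) (X : ∀ n, ι → Finset (V n))
    (hX : ∀ n v, ∃ i, v ∈ X n i) {c α : ι → ℝ} (hc : ∀ i, 0 < c i)
    (hpX : ∀ n i, ∀ x ∈ X n i, ∀ y ∈ X n i, x ≠ y → -Real.log (1 - p n s(x, y)) = c i)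
    (hα : ∀ i, Tendsto (fun n => ((X n i).card : ℝ) / n) atTop (𝓝 (α i))) {ρ : ℝ}
    (hρ : (∑ i, α i * c i) / 2 < ρ) :
    Tendsto (fun n => independentEdges (V n) (p n) {G | ¬ chi G ≤ ρ * (n / Real.log n)})
      atTop (𝓝 0) := by
  obtain ⟨ε, hε, hε1, hερ⟩ := exists_add_div_two_sub_lt (A := 0) (by rwa [zero_add])
  rw [zero_add] at hερ
  refine tendsto_of_tendsto_of_tendsto_of_le_of_le' tendsto_const_nhds
    (tendsto_card_mul_exp_neg (Fintype.card ι)) (Eventually.of_forall fun _ => zero_le) ?_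
  filter_upwards [eventually_all.2 fun i => eventually_not_hasSoloSets_le (hc i) hε hε1,
    (tendsto_sum_soloSize hc hε1 hα).eventually (gt_mem_nhds hερ), eventually_gt_atTop 0,
    tendsto_log_natCast.eventually_gt_atTop 0, eventually_all.2 fun i =>
      (tendsto_soloSize (hc i) hε1).eventually (lt_mem_nhds (div_pos (by linarith) (hc i)))]
    with n hsolo hsum hn hL hpos
  have hsub : {G : SimpleGraph (V n) | ¬ chi G ≤ ρ * (n / Real.log n)} ⊆ ⋃ i ∈ Finset.univ,
      {G | ¬ HasProfileSets G (X n i) ∅ (bulkSize n) (soloSize ε (c i) n) 0} := by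
    intro G hG
    by_contra hno
    refine hG ?_
    simp only [Finset.mem_univ, Set.iUnion_true, Set.mem_iUnion, Set.mem_ofPred_eq, not_exists,
      not_not] at hno
    obtain ⟨t, ht, htb⟩ := exists_colorableOn_biUnion Finset.univ (X n) _ fun i _ =>
      (hno i).exists_colorableOn (Nat.pos_of_ne_zero fun h => by simpa [h] using hpos i) le_rfl
    have huniv : Finset.univ.biUnion (X n) = Finset.univ := by
      ext v
      simpa using hX n v
    rw [huniv] at ht
    exact (chi_le_of_colorableOn ht).trans (htb.trans
      (le_mul_div_of_mul_div_le hL (by exact_mod_cast hn) hsum.le))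
  refine (measure_mono hsub).trans ((measure_biUnion_finset_le _ _).trans ?_)
  refine (Finset.sum_le_card_nsmul _ _ _ fun i _ =>
    hsolo i (V n) (p n) (X n i) (hV n) (hp n) (hpX n i)).trans ?_
  rw [nsmul_eq_mul, Finset.card_univ]

/-- About t·n/log n mixed classes, each of weight about (2 + η) log n, leave weight (C - t(2 + η))n
for solo classes, where C = Σ α_i c_i. The total is t + (C - t(2 + η))/2 = C/2 - tη/2 in units of
n/log n. -/
theorem exists_tendsto_lt_chi [DecidableEq ι] (p : ∀ n, Sym2 (V n) → I) (hp : ∀ n e, (p n e : ℝ) < 1)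
    (hV : ∀ n, Fintype.card (V n) ≤ n) (X : ∀ n, ι → Finset (V n))
    (hX : ∀ n v, ∃ i, v ∈ X n i) {c α : ι → ℝ} (hc : ∀ i, 0 < c i)
    (hpX : ∀ n i, ∀ x ∈ X n i, ∀ y ∈ X n i, x ≠ y → -Real.log (1 - p n s(x, y)) = c i)
    (hα : ∀ i, Tendsto (fun n => ((X n i).card : ℝ) / n) atTop (𝓝 (α i)))
    {i j : ι} (hij : i ≠ j) (hdisj : ∀ n, Disjoint (X n i) (X n j)) {c' : ℝ}
    (hc' : c' < (c i + c j) / 2)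
    (hpij : ∀ n, ∀ x ∈ X n i, ∀ y ∈ X n j, -Real.log (1 - p n s(x, y)) = c')
    (hαi : 0 < α i) (hαj : 0 < α j) :
    ∃ ρ < (∑ i, α i * c i) / 2,
      Tendsto (fun n => independentEdges (V n) (p n) {G | ¬ chi G ≤ ρ * (n / Real.log n)})
        atTop (𝓝 0) := by
  obtain ⟨η, hη, hmixed⟩ := eventually_not_hasMixedSets_le (hc i) (hc j) hc'
  have hci := hc i
  have hcj := hc j
  -- `t` is small enough that the mixed classes exhaust neither part; `β` below holds the densities
  -- that remain.
  obtain ⟨t, ht, hti, htj⟩ : ∃ t > 0, t * (1 / c i) < α i ∧ t * ((1 + η) / c j) < α j := by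
    refine ⟨min (α i * c i) (α j * c j / (1 + η)) / 2, by positivity, ?_, ?_⟩
    · have h := min_le_left (α i * c i) (α j * c j / (1 + η))
      rw [mul_one_div, div_lt_iff₀ hci]
      have : 0 < α i * c i := by positivity
      linarith
    · have h := min_le_right (α i * c i) (α j * c j / (1 + η))
      have h0 : 0 < α j * c j := by positivity
      rw [le_div_iff₀ (by linarith)] at h
      rw [mul_div_assoc', div_lt_iff₀ hcj]
      linarith
  set β : ι → ℝ := fun l => α l - (if l = i then t * (1 / c i) else 0) -
    (if l = j then t * ((1 + η) / c j) else 0) with hβ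
  have hβsum : ∑ l, β l * c l = ∑ l, α l * c l - t * (2 + η) := by
    simp only [hβ, sub_mul, Finset.sum_sub_distrib, ite_mul, zero_mul, Finset.sum_ite_eq',
      Finset.mem_univ, if_true]
    field_simp
    ring
  -- Half of the saving tη/2 is kept; the other half absorbs the error from 2 - ε.
  refine ⟨(∑ i, α i * c i) / 2 - t * η / 4, by linarith [mul_pos ht hη], ?_⟩
  set ρ := (∑ i, α i * c i) / 2 - t * η / 4 with hρ
  obtain ⟨ε, hε, hε1, hερ⟩ := exists_add_div_two_sub_lt (A := t) (B := ∑ l, β l * c l) (ρ := ρ)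
    (by rw [hβsum, hρ]; linarith [mul_pos ht hη])
  set a : ℕ → ℕ := fun n => ⌊Real.log n / c i⌋₊ with ha
  set b : ℕ → ℕ := fun n => ⌊(1 + η) * Real.log n / c j⌋₊ with hb
  set T : ℕ → ℕ := fun n => ⌊t * (n / Real.log n)⌋₊ with hT
  have hnlog : Tendsto (fun n : ℕ => (n : ℝ) / Real.log n) atTop atTop := by
    refine tendsto_atTop_mono' atTop ?_ tendsto_log_natCast
    filter_upwards [eventually_bulkSize 1, tendsto_log_natCast.eventually_ge_atTop 1] with n h hL
    rw [one_mul, bulkSize, le_div_iff₀ (by positivity)] at h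
    rw [le_div_iff₀ (by positivity)]
    refine le_trans ?_ h
    gcongr
    exact le_self_pow₀ hL (by norm_num)
  have hTlim : Tendsto (fun n => (T n : ℝ) * Real.log n / n) atTop (𝓝 t) := by
    refine ((tendsto_nat_floor_mul_div_atTop ht.le).comp hnlog).congr fun n => ?_
    simp only [Function.comp, hT, div_div_eq_mul_div]
  have halim : Tendsto (fun n => (a n : ℝ) / Real.log n) atTop (𝓝 (1 / c i)) := by
    simpa only [ha, div_mul_eq_mul_div, one_mul] using
      tendsto_floor_mul_log_div (x := 1 / c i) (by positivity)
  have hblim : Tendsto (fun n => (b n : ℝ) / Real.log n) atTop (𝓝 ((1 + η) / c j)) := by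
    simpa only [hb, div_mul_eq_mul_div] using
      tendsto_floor_mul_log_div (x := (1 + η) / c j) (by positivity)
  have hmul {g : ℕ → ℕ} {x : ℝ} (hg : Tendsto (fun n => (g n : ℝ) / Real.log n) atTop (𝓝 x)) :
      Tendsto (fun n => (g n * T n : ℝ) / n) atTop (𝓝 (t * x)) := by
    refine (hTlim.mul hg).congr' ?_
    filter_upwards [tendsto_log_natCast.eventually_gt_atTop 0] with n hL
    field_simp
  set f : ι → ℕ → ℝ := fun l n => (X n l).card - (if l = i then (a n * T n : ℝ) else 0) -
    (if l = j then (b n * T n : ℝ) else 0) with hf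
  have hflim (l : ι) : Tendsto (fun n => f l n / n) atTop (𝓝 (β l)) := by
    have hite {g : ℕ → ℝ} {x : ℝ} (q : Prop) [Decidable q]
        (hg : Tendsto (fun n => g n / n) atTop (𝓝 x)) :
        Tendsto (fun n => (if q then g n else 0) / (n : ℝ)) atTop (𝓝 (if q then x else 0)) := by
      split_ifs
      · exact hg
      · simp
    simp only [hf, sub_div]
    exact ((hα l).sub (hite _ (hmul halim))).sub (hite _ (hmul hblim))
  have hbulk0 : Tendsto (fun n : ℕ => bulkSize n / n) atTop (𝓝 0) := by
    refine (tendsto_bulkSize.mul (tendsto_inv_atTop_zero.comp tendsto_log_natCast)).congr' ?_ |>.trans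
      (by simp)
    filter_upwards [tendsto_log_natCast.eventually_gt_atTop 0] with n hL
    simp only [Function.comp]
    field_simp
  have hroom {g : ℕ → ℕ} {x : ℝ} {l : ι}
      (hg : Tendsto (fun n => (g n : ℝ) / Real.log n) atTop (𝓝 x)) (hx : t * x < α l) :
      ∀ᶠ n in atTop, bulkSize n + g n * T n ≤ (X n l).card := by
    have h1 := hbulk0.add (hmul hg)
    rw [zero_add] at h1
    filter_upwards [h1.eventually_lt (hα l) hx, eventually_gt_atTop 0] with n h hn
    have hn' : (0 : ℝ) < n := by exact_mod_cast hn
    rw [← add_div, div_lt_div_iff_of_pos_right hn'] at h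
    exact h.le
  have hcount := hTlim.add (tendsto_sum_soloSize hc hε1 hflim)
  refine tendsto_of_tendsto_of_tendsto_of_le_of_le' tendsto_const_nhds
    (tendsto_card_mul_exp_neg (Fintype.card ι + 1)) (Eventually.of_forall fun _ => zero_le) ?_
  filter_upwards [eventually_all.2 fun i => eventually_not_hasSoloSets_le (hc i) hε hε1,
    hmixed, hcount.eventually (gt_mem_nhds hερ), eventually_gt_atTop 0,
    tendsto_log_natCast.eventually_gt_atTop 0, eventually_all.2 fun i =>
      (tendsto_soloSize (hc i) hε1).eventually (lt_mem_nhds (div_pos (by linarith) (hc i))),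
    hroom halim hti, hroom hblim htj]
    with n hsolo hmixed hsum hn hL hpos hroomi hroomj
  have hsub : {G : SimpleGraph (V n) | ¬ chi G ≤ ρ * (n / Real.log n)} ⊆
      (⋃ i ∈ Finset.univ,
        {G | ¬ HasProfileSets G (X n i) ∅ (bulkSize n) (soloSize ε (c i) n) 0}) ∪
      {G | ¬ HasProfileSets G (X n i) (X n j) (bulkSize n) (a n) (b n)} := by
    intro G hG
    by_contra hno
    refine hG ?_
    simp only [Finset.mem_univ, Set.iUnion_true, Set.mem_union, Set.mem_iUnion, Set.mem_ofPred_eq,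
      not_or, not_exists, not_not] at hno
    obtain ⟨hsoloG, hmixedG⟩ := hno
    obtain ⟨X', hX', Y', hY', hXc, hYc, hcol⟩ :=
      hmixedG.exists_colorableOn_sdiff (hdisj n) (T n) hroomi hroomj
    set U : ι → Finset (V n) := fun l => if l = i then X' else if l = j then Y' else X n l with hU
    have hUX (l : ι) : U l ⊆ X n l := by
      by_cases h1 : l = i
      · subst h1; simpa [hU] using hX'
      · by_cases h2 : l = j
        · subst h2; simpa [hU, h1] using hY'
        · simp [hU, h1, h2]
    have hUc (l : ι) : ((U l).card : ℝ) = f l n := by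
      by_cases h1 : l = i
      · subst h1; simp [hU, hf, hXc, hij]
      · by_cases h2 : l = j
        · subst h2; simp [hU, hf, hYc, h1]
        · simp [hU, hf, h1, h2]
    obtain ⟨t', ht', htb⟩ := exists_colorableOn_biUnion Finset.univ U
      (fun l => f l n / soloSize ε (c l) n + bulkSize n) fun l _ => by
        rw [← hUc]
        exact (hsoloG l).exists_colorableOn
          (Nat.pos_of_ne_zero fun h => by simpa [h] using hpos l) (hUX l)
    have hall := hcol.union ht'
    have huniv : (X n i \ X') ∪ (X n j \ Y') ∪ Finset.univ.biUnion U = Finset.univ := by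
      ext v
      simp only [Finset.mem_univ, iff_true, Finset.mem_union, Finset.mem_sdiff,
        Finset.mem_biUnion, true_and]
      by_contra hv
      push Not at hv
      obtain ⟨⟨h1, h2⟩, h3⟩ := hv
      obtain ⟨l, hl⟩ := hX n v
      have h4 := h3 l
      by_cases hli : l = i
      · subst hli
        exact h4 (by simpa [hU] using h1 hl)
      · by_cases hlj : l = j
        · subst hlj
          exact h4 (by simpa [hU, hli] using h2 hl)
        · exact h4 (by simpa [hU, hli, hlj] using hl)
    rw [huniv] at hall
    refine (chi_le_of_colorableOn hall).trans
      (le_mul_div_of_mul_div_le hL (by exact_mod_cast hn) (le_trans ?_ hsum.le))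
    rw [← add_div, ← add_mul]
    push_cast
    gcongr
  refine (measure_mono hsub).trans ((measure_union_le _ _).trans ?_)
  push_cast
  rw [add_mul, one_mul]
  refine add_le_add ((measure_biUnion_finset_le _ _).trans ?_)
    (hmixed (V n) (p n) (X n i) (X n j) (hV n) (hp n) (hdisj n) (hpX n i) (hpX n j) (hpij n))
  refine (Finset.sum_le_card_nsmul _ _ _ fun i _ =>
    hsolo i (V n) (p n) (X n i) (hV n) (hp n) (hpX n i)).trans ?_
  rw [nsmul_eq_mul, Finset.card_univ]

end Sequence

/-! ### Block sizes and parts -/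

section BlockSize

variable {k : ℕ} {α : Fin k → ℝ}

lemma sum_eq_sum_filter_add_last {M : Type*} [AddCommMonoid M] (f : Fin k → M)
    {i : Fin k} (hi : (i : ℕ) + 1 = k) :
    ∑ j, f j = ∑ j ∈ Finset.univ.filter (fun j : Fin k => (j : ℕ) + 1 < k), f j + f i := by
  rw [← Finset.sum_filter_add_sum_filter_not Finset.univ (fun j : Fin k => (j : ℕ) + 1 < k)]
  congr 1
  have : Finset.univ.filter (fun j : Fin k => ¬ (j : ℕ) + 1 < k) = {i} := by
    ext j
    simp only [Finset.mem_filter, Finset.mem_univ, true_and, Finset.mem_singleton, Fin.ext_iff]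
    omega
  rw [this, Finset.sum_singleton]

lemma sum_floor_le (hα : ∀ i, 0 < α i) (hsum : ∑ i, α i = 1) (n : ℕ) :
    ∑ j ∈ Finset.univ.filter (fun j : Fin k => (j : ℕ) + 1 < k), ⌊α j * n⌋₊ ≤ n := by
  have h : (∑ j ∈ Finset.univ.filter (fun j : Fin k => (j : ℕ) + 1 < k), (⌊α j * n⌋₊ : ℝ)) ≤ n :=
    calc _ ≤ ∑ j ∈ Finset.univ.filter (fun j : Fin k => (j : ℕ) + 1 < k), α j * n :=
          Finset.sum_le_sum fun j _ => Nat.floor_le (mul_nonneg (hα j).le (Nat.cast_nonneg n))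
      _ ≤ ∑ j, α j * n := Finset.sum_le_sum_of_subset_of_nonneg (Finset.filter_subset _ _)
          fun j _ _ => mul_nonneg (hα j).le (Nat.cast_nonneg n)
      _ = n := by rw [← Finset.sum_mul, hsum, one_mul]
  exact_mod_cast h

lemma pos_of_sum_eq_one (hsum : ∑ i, α i = 1) : 0 < k := by
  rcases Nat.eq_zero_or_pos k with rfl | h
  · simp at hsum
  · exact h

lemma sum_blockSize (hα : ∀ i, 0 < α i) (hsum : ∑ i, α i = 1) (n : ℕ) :
    ∑ i, blockSize α n i = n := by
  have hk := pos_of_sum_eq_one hsum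
  have hi : ((⟨k - 1, by omega⟩ : Fin k) : ℕ) + 1 = k := by simp; omega
  rw [sum_eq_sum_filter_add_last _ hi, Finset.sum_congr rfl (g := fun j => ⌊α j * n⌋₊),
    blockSize, if_pos hi]
  · exact Nat.add_sub_cancel' (sum_floor_le hα hsum n)
  · intro j hj
    have := (Finset.mem_filter.1 hj).2
    rw [blockSize, if_neg (by omega)]

lemma blockSize_le (hα : ∀ i, 0 < α i) (hsum : ∑ i, α i = 1) (n : ℕ) (i : Fin k) :
    blockSize α n i ≤ n :=
  (Finset.single_le_sum (fun _ _ => Nat.zero_le _) (Finset.mem_univ i)).trans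
    (sum_blockSize hα hsum n).le

lemma tendsto_blockSize (hα : ∀ i, 0 < α i) (hsum : ∑ i, α i = 1) (i : Fin k) :
    Tendsto (fun n => (blockSize α n i : ℝ) / n) atTop (𝓝 (α i)) := by
  have hfl (j : Fin k) : Tendsto (fun n : ℕ => (⌊α j * n⌋₊ : ℝ) / n) atTop (𝓝 (α j)) :=
    (tendsto_nat_floor_mul_div_atTop (hα j).le).comp tendsto_natCast_atTop_atTop
  by_cases hi : (i : ℕ) + 1 = k
  · have h := tendsto_const_nhds (x := (1 : ℝ)).sub (tendsto_finsetSum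
      (Finset.univ.filter (fun j : Fin k => (j : ℕ) + 1 < k)) fun j _ => hfl j)
    have hlim := sum_eq_sum_filter_add_last α hi
    rw [hsum] at hlim
    rw [hlim, add_sub_cancel_left] at h
    rw [← hlim] at h
    refine h.congr' ?_
    filter_upwards [eventually_gt_atTop 0] with n hn
    have hn' : (n : ℝ) ≠ 0 := by positivity
    rw [blockSize, if_pos hi, Nat.cast_sub (sum_floor_le hα hsum n), sub_div, div_self hn',
      Nat.cast_sum, Finset.sum_div]
  · simpa only [blockSize, if_neg hi] using hfl i

/-- The `i`-th part of the vertex set. -/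
def part (α : Fin k → ℝ) (n : ℕ) (i : Fin k) : Finset (BlockVertex α n) :=
  Finset.univ.map (Function.Embedding.sigmaMk i)

lemma mem_part {n : ℕ} {i : Fin k} {v : BlockVertex α n} : v ∈ part α n i ↔ v.1 = i := by
  obtain ⟨j, x⟩ := v
  simp only [part, Finset.mem_map, Finset.mem_univ, true_and, Function.Embedding.sigmaMk_apply]
  constructor
  · rintro ⟨y, hy⟩
    exact (congrArg Sigma.fst hy).symm
  · rintro rfl
    exact ⟨x, rfl⟩

lemma card_part (n : ℕ) (i : Fin k) : (part α n i).card = blockSize α n i := by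
  simp [part]

lemma card_blockVertex (hα : ∀ i, 0 < α i) (hsum : ∑ i, α i = 1) (n : ℕ) :
    Fintype.card (BlockVertex α n) = n := by
  simp [sum_blockSize hα hsum]

end BlockSize

lemma one_sub_sqrt_le_iff {p q r : ℝ} (hp : p < 1) (hq : q < 1) (hr : r < 1) :
    1 - Real.sqrt ((1 - p) * (1 - q)) ≤ r ↔
      (-Real.log (1 - p) + -Real.log (1 - q)) / 2 ≤ -Real.log (1 - r) := by
  have hp' : 0 < 1 - p := by linarith
  have hq' : 0 < 1 - q := by linarith
  have hr' : 0 < 1 - r := by linarith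
  have hs : 0 < Real.sqrt ((1 - p) * (1 - q)) := Real.sqrt_pos.2 (by positivity)
  have h : Real.log (Real.sqrt ((1 - p) * (1 - q))) =
      (Real.log (1 - p) + Real.log (1 - q)) / 2 := by
    rw [Real.log_sqrt (by positivity), Real.log_mul hp'.ne' hq'.ne']
  have h2 := Real.log_le_log_iff hr' hs
  rw [h] at h2
  constructor
  · intro h3
    have := h2.2 (by linarith)
    linarith
  · intro h3
    have := h2.1 (by linarith)
    linarith

/-! ### Events of vanishing probability -/

section Negligible

variable {Ω : ℕ → Type*} [∀ n, MeasurableSpace (Ω n)] {μ : ∀ n, Measure (Ω n)}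

lemma tendsto_measure_zero_of_subset {A B : ∀ n, Set (Ω n)}
    (hA : Tendsto (fun n => μ n (A n)) atTop (𝓝 0)) (h : ∀ᶠ n in atTop, B n ⊆ A n) :
    Tendsto (fun n => μ n (B n)) atTop (𝓝 0) :=
  tendsto_of_tendsto_of_tendsto_of_le_of_le' tendsto_const_nhds hA
    (Eventually.of_forall fun _ => zero_le) (h.mono fun _ h => measure_mono h)

lemma tendsto_measure_union_zero {A B : ∀ n, Set (Ω n)}
    (hA : Tendsto (fun n => μ n (A n)) atTop (𝓝 0))
    (hB : Tendsto (fun n => μ n (B n)) atTop (𝓝 0)) :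
    Tendsto (fun n => μ n (A n ∪ B n)) atTop (𝓝 0) := by
  have h := hA.add hB
  rw [add_zero] at h
  exact tendsto_of_tendsto_of_tendsto_of_le_of_le tendsto_const_nhds h
    (fun _ => zero_le) fun n => measure_union_le _ _

lemma tendsto_measure_iUnion_zero {ι : Type*} [Fintype ι] {A : ι → ∀ n, Set (Ω n)}
    (hA : ∀ i, Tendsto (fun n => μ n (A i n)) atTop (𝓝 0)) :
    Tendsto (fun n => μ n (⋃ i, A i n)) atTop (𝓝 0) := by
  have h := tendsto_finsetSum Finset.univ fun i (_ : i ∈ Finset.univ) => hA i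
  rw [Finset.sum_const_zero] at h
  exact tendsto_of_tendsto_of_tendsto_of_le_of_le tendsto_const_nhds h
    (fun _ => zero_le) fun n => measure_iUnion_fintype_le _ _

/-- Subadditivity suffices, so the events need not be measurable. -/
lemma tendsto_measure_one_of_compl [∀ n, IsProbabilityMeasure (μ n)] {A : ∀ n, Set (Ω n)}
    (hA : Tendsto (fun n => μ n (A n)ᶜ) atTop (𝓝 0)) :
    Tendsto (fun n => μ n (A n)) atTop (𝓝 1) := by
  have h : Tendsto (fun n => 1 - μ n (A n)ᶜ) atTop (𝓝 (1 - 0)) :=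
    ENNReal.Tendsto.sub tendsto_const_nhds hA (Or.inl ENNReal.one_ne_top)
  rw [tsub_zero] at h
  refine tendsto_of_tendsto_of_tendsto_of_le_of_le h tendsto_const_nhds (fun n => ?_)
    fun n => prob_le_one
  rw [tsub_le_iff_right, ← measure_univ (μ := μ n), ← Set.union_compl_self (A n)]
  exact measure_union_le _ _

/-- Only marginal laws enter, which is why the joint distribution is arbitrary. -/
lemma tendsto_of_hasLaw {V : ℕ → Type} [∀ n, Fintype (V n)] {G : ∀ n, Ω n → SimpleGraph (V n)}
    {ν : ∀ n, Measure (SimpleGraph (V n))} (hG : ∀ n, HasLaw (G n) (ν n) (μ n))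
    {Φ : ∀ n, SimpleGraph (V n) → Prop}
    (h : Tendsto (fun n => ν n {G | Φ n G}) atTop (𝓝 0)) :
    Tendsto (fun n => μ n {ω | Φ n (G n ω)}) atTop (𝓝 0) :=
  h.congr fun n => ((hG n).measure_eq (measurableSet_simpleGraph _)).symm

end Negligible

end RandomBlockGraph

end

/-! ### Deduction of the equivalence -/

open RandomBlockGraph in
/-- For each `n`, the graphs `G n ∼ G(n, α, P)` and `H n i ∼ G(|V_i|, p_i)` live on one
probability space, with an arbitrary joint distribution. -/
theorem mainTheorem2 {k : ℕ} (α : Fin k → ℝ) (hα : ∀ i, 0 < α i ∧ α i ≤ 1) (hα_sum : ∑ i, α i = 1)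
    (P : Matrix (Fin k) (Fin k) unitInterval) (hP_symm : P.IsSymm)
    (hP : ∀ i j, 0 < (P i j : ℝ) ∧ (P i j : ℝ) < 1)
    {Ω : ℕ → Type*} [∀ n, MeasurableSpace (Ω n)] (μ : ∀ n, Measure (Ω n))
    [∀ n, IsProbabilityMeasure (μ n)]
    (G : ∀ n, Ω n → SimpleGraph (RandomBlockGraph.BlockVertex α n))
    (hG : ∀ n, HasLaw (G n) (RandomBlockGraph.blockRandom n α P hP_symm) (μ n))
    (H : ∀ n (i : Fin k), Ω n → SimpleGraph (Fin (RandomBlockGraph.blockSize α n i)))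
    (hH : ∀ n i, HasLaw (H n i)
      (SimpleGraph.binomialRandom (Fin (RandomBlockGraph.blockSize α n i)) (P i i)) (μ n)) :
    RandomBlockGraph.WhpAsymptoticallyEq μ (fun n ω => RandomBlockGraph.chi (G n ω))
        (fun n ω => ∑ i, RandomBlockGraph.chi (H n i ω)) ↔
      ∀ i j : Fin k, i < j →
        (P i j : ℝ) ≥ 1 - Real.sqrt ((1 - (P i i : ℝ)) * (1 - (P j j : ℝ))) := by
  have hα0 (i) : 0 < α i := (hα i).1
  set c : Fin k → ℝ := fun i => -Real.log (1 - P i i) with hc_def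
  have hc (i) : 0 < c i := neg_pos.2 (Real.log_neg (by linarith [(hP i i).2]) (by
    linarith [(hP i i).1]))
  set C := ∑ i, α i * c i with hC_def
  have hk : 0 < k := pos_of_sum_eq_one hα_sum
  have : Nonempty (Fin k) := ⟨⟨0, hk⟩⟩
  have hC : 0 < C := Finset.sum_pos (fun i _ => mul_pos (hα0 i) (hc i)) Finset.univ_nonempty
  set p : ∀ n, Sym2 (BlockVertex α n) → I := fun n =>
    Sym2.lift ⟨fun u v => P u.1 v.1, fun u v => hP_symm.apply v.1 u.1⟩ with hp_def
  have hp (n) (u v : BlockVertex α n) : p n s(u, v) = P u.1 v.1 := rfl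
  have hp1 (n) (e) : (p n e : ℝ) < 1 := by
    induction e with
    | _ u v => exact (hP u.1 v.1).2
  have hcard (n) : Fintype.card (BlockVertex α n) ≤ n := (card_blockVertex hα0 hα_sum n).le
  have hpart (n) (v : BlockVertex α n) : ∃ i, v ∈ part α n i := ⟨v.1, mem_part.2 rfl⟩
  have hpX (n) (i) : ∀ x ∈ part α n i, ∀ y ∈ part α n i, x ≠ y →
      -Real.log (1 - p n s(x, y)) = c i := by
    intro x hx y hy _
    rw [hp, mem_part.1 hx, mem_part.1 hy]
  have hpartlim (i) : Tendsto (fun n => ((part α n i).card : ℝ) / n) atTop (𝓝 (α i)) := by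
    simpa only [card_part] using tendsto_blockSize hα0 hα_sum i
  have hHle {i : Fin k} {ρ : ℝ} (hρ : α i * c i / 2 < ρ) :
      Tendsto (fun n => μ n {ω | ¬ chi (H n i ω) ≤ ρ * (n / Real.log n)}) atTop (𝓝 0) := by
    refine tendsto_of_hasLaw (fun n => hH n i)
      (Φ := fun n G => ¬ chi G ≤ ρ * (n / Real.log n)) ?_
    simp only [binomialRandom_eq_independentEdges]
    refine tendsto_lt_chi (ι := Unit) (c := fun _ => c i) (α := fun _ => α i)
      (fun n _ => P i i) (fun n _ => (hP i i).2)
      (fun n => by simpa using blockSize_le hα0 hα_sum n i) (fun n _ => Finset.univ)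
      (fun n v => ⟨(), Finset.mem_univ v⟩) (fun _ => hc i) (fun _ _ _ _ _ _ _ => rfl)
      (fun _ => by simpa using tendsto_blockSize hα0 hα_sum i) (by simpa using hρ)
  have hHge {i : Fin k} {ρ : ℝ} (hρ0 : 0 ≤ ρ) (hρ : ρ < α i * c i / 2) :
      Tendsto (fun n => μ n {ω | ¬ ρ * (n / Real.log n) ≤ chi (H n i ω)}) atTop (𝓝 0) := by
    refine tendsto_of_hasLaw (fun n => hH n i)
      (Φ := fun n G => ¬ ρ * (n / Real.log n) ≤ chi G) ?_
    simp only [binomialRandom_eq_independentEdges]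
    refine tendsto_chi_lt (fun n _ => P i i) (fun n _ => (hP i i).2)
      (fun n => by simpa using blockSize_le hα0 hα_sum n i) (fun _ _ => c i) (hc i)
      (fun _ _ => le_rfl) (fun n x y _ => by simp [hc_def]) ?_ hρ0 hρ
    simp only [Finset.sum_const, Finset.card_univ, Fintype.card_fin, nsmul_eq_mul,
      mul_div_right_comm]
    exact (tendsto_blockSize hα0 hα_sum i).mul_const (c i)
  have hYle {δ : ℝ} (hδ : 0 < δ) : Tendsto (fun n => μ n
      {ω | ¬ ∑ i, chi (H n i ω) ≤ (C / 2 + δ) * (n / Real.log n)}) atTop (𝓝 0) := by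
    refine tendsto_measure_zero_of_subset (tendsto_measure_iUnion_zero fun i =>
      hHle (i := i) (ρ := α i * (c i / 2 + δ)) (by nlinarith [mul_pos (hα0 i) hδ]))
      (Eventually.of_forall fun n ω hω => ?_)
    by_contra hno
    simp only [Set.mem_iUnion, Set.mem_ofPred_eq, not_exists, not_not] at hno
    refine hω ((Finset.sum_le_sum fun i _ => hno i).trans (le_of_eq ?_))
    rw [← Finset.sum_mul]
    simp only [mul_add, Finset.sum_add_distrib, ← Finset.sum_mul, hα_sum, one_mul, mul_div_assoc',
      ← Finset.sum_div, hC_def]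
  have hYge {δ : ℝ} (hδ : 0 < δ) : Tendsto (fun n => μ n
      {ω | ¬ (C / 2 - δ) * (n / Real.log n) ≤ ∑ i, chi (H n i ω)}) atTop (𝓝 0) := by
    -- The error δ is shared in proportion to `α i`; the maximum with 0 meets the sign condition of
    -- `hHge`.
    refine tendsto_measure_zero_of_subset (tendsto_measure_iUnion_zero fun i =>
      hHge (i := i) (ρ := α i * max (c i / 2 - δ) 0)
        (mul_nonneg (hα0 i).le (le_max_right _ _)) (by
          rw [mul_div_assoc]
          exact mul_lt_mul_of_pos_left (max_lt (by linarith) (by linarith [hc i])) (hα0 i)))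
      (Eventually.of_forall fun n ω hω => ?_)
    by_contra hno
    simp only [Set.mem_iUnion, Set.mem_ofPred_eq, not_exists, not_not] at hno
    refine hω (le_trans ?_ (Finset.sum_le_sum fun i _ => hno i))
    rw [← Finset.sum_mul]
    refine mul_le_mul_of_nonneg_right ?_ (div_nonneg (Nat.cast_nonneg n)
      (Real.log_natCast_nonneg n))
    calc C / 2 - δ = ∑ i, α i * (c i / 2 - δ) := by
          simp only [mul_sub, Finset.sum_sub_distrib, ← Finset.sum_mul, hα_sum, one_mul,
            mul_div_assoc', ← Finset.sum_div, hC_def]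
      _ ≤ _ := Finset.sum_le_sum fun i _ =>
          mul_le_mul_of_nonneg_left (le_max_left _ _) (hα0 i).le
  constructor
  · intro hwhp i j hij
    by_contra hlt
    rw [ge_iff_le, one_sub_sqrt_le_iff (hP i i).2 (hP j j).2 (hP i j).2, not_le] at hlt
    obtain ⟨ρ, hρ, hρlim⟩ := exists_tendsto_lt_chi p hp1 hcard (part α) hpart hc hpX hpartlim
      hij.ne (fun n => Finset.disjoint_left.2 fun x hx hy =>
        hij.ne ((mem_part.1 hx).symm.trans (mem_part.1 hy))) hlt
      (fun n x hx y hy => by rw [hp, mem_part.1 hx, mem_part.1 hy]) (hα0 i) (hα0 j)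
    have hXle := tendsto_of_hasLaw hG hρlim
    obtain ⟨ε, hε0, hε1, hε⟩ : ∃ ε : ℝ, 0 < ε ∧ ε < 1 ∧ ρ < (1 - ε) * (C / 2 - ε) := by
      have hcont : ContinuousAt (fun ε : ℝ => (1 - ε) * (C / 2 - ε)) 0 := by fun_prop
      have h0 : ∀ᶠ ε : ℝ in 𝓝[>] 0, ρ < (1 - ε) * (C / 2 - ε) :=
        nhdsWithin_le_nhds (hcont.eventually (lt_mem_nhds (by simpa using hρ)))
      have h1 : ∀ᶠ ε : ℝ in 𝓝[>] 0, ε < 1 := nhdsWithin_le_nhds (gt_mem_nhds one_pos)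
      obtain ⟨ε, h0, h1, h2⟩ :=
        (h0.and (h1.and (self_mem_nhdsWithin (a := (0 : ℝ)) (s := Set.Ioi 0)))).exists
      exact ⟨ε, h2, h1, h0⟩
    -- Closeness would give χ(G_n) ≥ (1 - ε)(C/2 - ε) n/log n > ρ n/log n, so its probability tends
    -- to 0 as well as to 1.
    have hzero := tendsto_measure_zero_of_subset (tendsto_measure_union_zero hXle (hYge hε0))
      (B := fun n => {ω | |chi (G n ω) - ∑ i, chi (H n i ω)| ≤ ε * ∑ i, chi (H n i ω)}) (by
        filter_upwards [eventually_gt_atTop 0, tendsto_log_natCast.eventually_gt_atTop 0]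
          with n hn hL ω hω
        by_contra hno
        simp only [Set.mem_union, Set.mem_ofPred_eq, not_or, not_not] at hno hω
        have hN : 0 < (n : ℝ) / Real.log n := by positivity
        have h1 := (abs_le.1 hω).1
        have h2 := mul_lt_mul_of_pos_right hε hN
        have h3 := mul_le_mul_of_nonneg_left hno.2 (by linarith : 0 ≤ 1 - ε)
        linarith [hno.1])
    exact zero_ne_one (tendsto_nhds_unique hzero (hwhp ε hε0))
  · intro hcond ε₀ hε₀
    have hcond' (i j : Fin k) : (c i + c j) / 2 ≤ -Real.log (1 - P i j) := by
      rcases lt_trichotomy i j with h | rfl | h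
      · exact (one_sub_sqrt_le_iff (hP i i).2 (hP j j).2 (hP i j).2).1 (hcond i j h)
      · simp [hc_def]
      · rw [← hP_symm.apply i j, add_comm]
        exact (one_sub_sqrt_le_iff (hP j j).2 (hP i i).2 (hP j i).2).1 (hcond j i h)
    -- Capping at 1 keeps `1 - ε` nonnegative for the lower deviation.
    set ε := min ε₀ 1 with hε_def
    have hε : 0 < ε := lt_min hε₀ one_pos
    have hε1 : ε ≤ 1 := min_le_right _ _
    -- The last bound is equivalent to C/2 + δ ≤ (1 + ε)(C/2 - δ), and implies the matching lower
    -- inequality.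
    obtain ⟨δ, hδ, hδC, hδε⟩ : ∃ δ > 0, δ < C / 2 ∧ (2 + ε) * δ ≤ ε * C / 2 := by
      refine ⟨ε * C / (2 * (2 + ε)), by positivity, ?_, le_of_eq (by field_simp)⟩
      rw [div_lt_div_iff₀ (by positivity) (by norm_num)]
      nlinarith
    have hXle : Tendsto (fun n => μ n {ω | ¬ chi (G n ω) ≤ (C / 2 + δ) * (n / Real.log n)})
        atTop (𝓝 0) :=
      tendsto_of_hasLaw hG (Φ := fun n G => ¬ chi G ≤ (C / 2 + δ) * (n / Real.log n))
        (tendsto_lt_chi p hp1 hcard (part α) hpart hc hpX hpartlim (by linarith))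
    have hXge : Tendsto (fun n => μ n {ω | ¬ (C / 2 - δ) * (n / Real.log n) ≤ chi (G n ω)})
        atTop (𝓝 0) := by
      refine tendsto_of_hasLaw hG (Φ := fun n G => ¬ (C / 2 - δ) * (n / Real.log n) ≤ chi G)
        (tendsto_chi_lt (s := C) (K := ∑ i, c i) p hp1 hcard (fun n v => c v.1)
          (Finset.sum_pos (fun i _ => hc i) Finset.univ_nonempty)
          (fun n v => Finset.single_le_sum (fun i _ => (hc i).le) (Finset.mem_univ v.1))
          (fun n x y _ => hcond' x.1 y.1) ?_ (by linarith) (by linarith))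
      have h := tendsto_finsetSum Finset.univ fun i (_ : i ∈ Finset.univ) =>
        (tendsto_blockSize hα0 hα_sum i).mul_const (c i)
      refine h.congr fun n => ?_
      rw [Fintype.sum_sigma, Finset.sum_div]
      exact Finset.sum_congr rfl fun i _ => by simp [mul_div_right_comm]
    refine tendsto_measure_one_of_compl (tendsto_measure_zero_of_subset
      (tendsto_measure_union_zero (tendsto_measure_union_zero hXle hXge)
        (tendsto_measure_union_zero (hYle hδ) (hYge hδ))) ?_)
    filter_upwards with n ω hω
    by_contra hno
    refine hω ?_
    simp only [Set.mem_union, Set.mem_ofPred_eq, not_or, not_not] at hno ⊢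
    obtain ⟨⟨h1, h2⟩, h3, h4⟩ := hno
    have hN : 0 ≤ (n : ℝ) / Real.log n := div_nonneg (Nat.cast_nonneg n)
      (Real.log_natCast_nonneg n)
    have hY : 0 ≤ ∑ i, chi (H n i ω) := Finset.sum_nonneg fun i _ => Nat.cast_nonneg _
    have hδN := mul_le_mul_of_nonneg_right hδε hN
    have hδN' := mul_nonneg (mul_nonneg hε.le hδ.le) hN
    have h5 := mul_le_mul_of_nonneg_left h4 hε.le
    have h6 := mul_le_mul_of_nonneg_left h3 (by linarith : 0 ≤ 1 - ε)
    refine le_trans (abs_le.2 ⟨?_, ?_⟩) (mul_le_mul_of_nonneg_right (min_le_left ε₀ 1) hY)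
    · linarith
    · linarith
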